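/- Let $c\ge 1/2$ be a real number. For a finite simple graph $G$ let $h(G)$ denote the number of distinct Hamilton cycles of $G$ (as subgraphs of $G$). Then every $cn$-regular graph $G$ on $n$ vertices (so $cn$ is an integer) satisfies $$h(G)=\left(\frac{cn}{e}\right)^n(1+o(1))^n\qquad (n\to\infty),$$ where the $o(1)$ term tends to $0$ uniformly over all such $G$. Precisely: for every $c\ge 1/2$ and every $\varepsilon>0$ there is an $N$ such that for every $n\ge N$ and every $cn$-regular graph $G$ on $n$ vertices there is a real number $\eta$ with $|\eta|\le\varepsilon$ and $$h(G)=\left(\frac{cn}{e}\right)^n(1+\eta)^n .$$ -/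

import Mathlib

namespace SimpleGraph

/-- The Hamilton cycles of a graph `G`, as subgraphs of `G`: each cycle is counted once,
independently of the choice of a starting vertex and of a direction of traversal. -/
def hamiltonCycles {V : Type*} [DecidableEq V] (G : SimpleGraph V) : Set G.Subgraph :=
  {H | ∃ (a : V) (p : G.Walk a a), p.IsHamiltonianCycle ∧ p.toSubgraph = H}

/-- The number `h(G)` of distinct Hamilton cycles of `G`. -/
noncomputable def numHamiltonCycles {V : Type*} [DecidableEq V] (G : SimpleGraph V) : ℕ :=
  G.hamiltonCycles.ncard

end SimpleGraph

/-! ### A lower bound for permanents through stable polynomials -/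

section Stable

open MvPolynomial

/-! Write `d = cn` and count the permutations moving every vertex to a neighbour, i.e. the permanent
of the adjacency matrix. Up to a polynomial factor it equals `(d/e)^n`: the lower bound is van der
Waerden's inequality in Gurvits' form (`permanent_fin_ge`, `card_perm_ge`), the upper bound is
Brégman's theorem (`log_card_bijectionsIn_le`). An oriented Hamilton cycle is such a permutation,
which settles the upper bound on `h(G)`.

For the lower bound, Brégman's theorem is also applied to permutations that fix a small set `S`:
each fixed vertex costs a factor `d`, with a polynomial error uniform in `S`
(`card_adjPerms_mul_le`). Hence a given vertex lies on a cycle of length at most `l` for a fraction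
of about `l/d` of the permutations, likewise jointly for several vertices on distinct cycles, and a
high factorial moment shows that at most half of the expected number have many short cycles
(`card_filter_shortCycles_le`). The rest have `O(n^(3/4))` cycles.

Writing these cycles one after another gives a cyclic ordering of the vertices with few non-adjacent
consecutive pairs, and the permutation is recovered from the ordering and few further data
(`card_filter_cycles_le`). As `n ≤ 2d`, Dirac's crossing argument removes such breaks one at a time,
each move being at most `n^2`-to-one (`card_orderings_succ_le`). The total loss is `n^O(n^(3/4)) =
(1+o(1))^n`. -/

theorem MvPolynomial.IsHomogeneous.eval_smul' {σ R : Type*} [CommSemiring R] {n : ℕ}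
    {p : MvPolynomial σ R} (hp : p.IsHomogeneous n) (a : R) (x : σ → R) :
    eval (fun i => a * x i) p = a ^ n * eval x p := by
  classical
  rw [eval_eq, eval_eq, Finset.mul_sum]
  refine Finset.sum_congr rfl fun d hd => ?_
  have hdeg : d.degree = n := by
    by_contra h
    exact (mem_support_iff.mp hd) (hp.coeff_eq_zero h)
  simp only [mul_pow, Finset.prod_mul_distrib, Finset.prod_pow_eq_pow_sum]
  rw [← hdeg, Finsupp.degree_apply]
  ring

/-- A polynomial is strongly stable when it does not vanish at vectors with nonnegative real parts,
not all zero. -/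
def MvPolynomial.StronglyStable {n : ℕ} (p : MvPolynomial (Fin n) ℂ) : Prop :=
  ∀ z : Fin n → ℂ, (∀ i, 0 ≤ (z i).re) → (∃ i, 0 < (z i).re) → eval z p ≠ 0

/-- The restriction of `p` to the line through `z` in the direction of the first variable. -/
noncomputable def MvPolynomial.line {n : ℕ} (p : MvPolynomial (Fin (n + 1)) ℂ) (z : Fin n → ℂ) :
    Polynomial ℂ :=
  (finSuccEquiv ℂ n p).map (eval z)

theorem MvPolynomial.eval_line {n : ℕ} (p : MvPolynomial (Fin (n + 1)) ℂ) (z : Fin n → ℂ) (t : ℂ) :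
    (p.line z).eval t = eval (Fin.cons t z : Fin (n + 1) → ℂ) p :=
  (eval_eq_eval_mv_eval' z t p).symm

theorem MvPolynomial.derivative_line_eval_zero {n : ℕ} (p : MvPolynomial (Fin (n + 1)) ℂ)
    (z : Fin n → ℂ) :
    (p.line z).derivative.eval 0 = eval z ((finSuccEquiv ℂ n p).coeff 1) := by
  rw [← Polynomial.coeff_zero_eq_eval_zero, Polynomial.coeff_derivative]
  simp [line]

variable {n : ℕ} {p : MvPolynomial (Fin (n + 1)) ℂ}

theorem MvPolynomial.StronglyStable.root_re_neg (hst : p.StronglyStable) {z : Fin n → ℂ}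
    (hz : ∀ i, 0 ≤ (z i).re) (hz' : ∃ i, 0 < (z i).re) {r : ℂ} (hr : r ∈ (p.line z).roots) :
    r.re < 0 := by
  by_contra! h
  have h0 : (p.line z).eval r = 0 := Polynomial.isRoot_of_mem_roots hr
  rw [eval_line] at h0
  refine hst _ ?_ ?_ h0
  · intro i
    refine Fin.cases ?_ (fun j => ?_) i
    · simpa using h
    · simpa using hz j
  · obtain ⟨i, hi⟩ := hz'
    exact ⟨i.succ, by simpa using hi⟩

theorem MvPolynomial.StronglyStable.line_eval_zero_ne (hst : p.StronglyStable) {z : Fin n → ℂ}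
    (hz : ∀ i, 0 ≤ (z i).re) (hz' : ∃ i, 0 < (z i).re) : (p.line z).eval 0 ≠ 0 := by
  rw [eval_line]
  refine hst _ ?_ ?_
  · intro i
    refine Fin.cases ?_ (fun j => ?_) i
    · simp
    · simpa using hz j
  · obtain ⟨i, hi⟩ := hz'
    exact ⟨i.succ, by simpa using hi⟩

/-- By homogeneity the coefficient of the top power of the first variable is a constant, so it can
be computed at `z = 0`. There it is the value of `p` at `(1, 0, ..., 0)`, nonzero by stability. -/
theorem MvPolynomial.StronglyStable.line_natDegree_ne_zero (hst : p.StronglyStable)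
    (hp : p.IsHomogeneous (n + 1)) (z : Fin n → ℂ) : (p.line z).natDegree ≠ 0 := by
  have ha : eval (Fin.cons 1 0 : Fin (n + 1) → ℂ) p ≠ 0 := by
    refine hst _ ?_ ⟨0, by simp⟩
    intro i
    refine Fin.cases ?_ (fun j => ?_) i <;> simp
  have h0 : p.line 0 = Polynomial.C (eval (Fin.cons 1 0 : Fin (n + 1) → ℂ) p) *
      Polynomial.X ^ (n + 1) := by
    refine Polynomial.funext fun t => ?_
    rw [eval_line]
    have : (Fin.cons t 0 : Fin (n + 1) → ℂ) = fun i => t * (Fin.cons 1 0 : Fin (n + 1) → ℂ) i := by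
      funext i
      refine Fin.cases ?_ (fun j => ?_) i <;> simp
    rw [this, hp.eval_smul']
    simp only [Polynomial.eval_mul, Polynomial.eval_C, Polynomial.eval_pow, Polynomial.eval_X]
    ring
  have hhom := hp.finSuccEquiv_coeff_isHomogeneous (n + 1) 0 (by simp)
  have hC := totalDegree_eq_zero_iff_eq_C.mp ((totalDegree_zero_iff_isHomogeneous (Fin n)).mpr hhom)
  have hcoeff : ∀ w : Fin n → ℂ, (p.line w).coeff (n + 1) = coeff 0
      ((finSuccEquiv ℂ n p).coeff (n + 1)) := by
    intro w
    rw [line, Polynomial.coeff_map, hC]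
    simp
  have hne : (p.line z).coeff (n + 1) ≠ 0 := by
    rw [hcoeff z, ← hcoeff 0, h0]
    simpa using ha
  have := Polynomial.le_natDegree_of_ne_zero hne
  omega

/-- A Gauss–Lucas argument: the logarithmic derivative at `0` is the sum of `-1/r` over the roots
`r`. All roots lie in the open left half plane, so every term has positive real part, and there is
at least one root. -/
theorem MvPolynomial.StronglyStable.coeff_one (hst : p.StronglyStable)
    (hp : p.IsHomogeneous (n + 1)) : ((finSuccEquiv ℂ n p).coeff 1).StronglyStable := by
  intro z hz hz'
  have hne := hst.line_eval_zero_ne hz hz'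
  have hsp : (p.line z).Splits := IsAlgClosed.splits _
  rw [← derivative_line_eval_zero, hsp.eval_derivative_eq_eval_mul_sum hne]
  refine mul_ne_zero hne fun hsum => ?_
  have hroots : (p.line z).roots ≠ 0 := by
    intro h
    have := hsp.natDegree_eq_card_roots
    rw [h] at this
    exact hst.line_natDegree_ne_zero hp z (by simpa using this)
  have hre : (((p.line z).roots.map fun r => 1 / (0 - r)).map Complex.re).sum = 0 := by
    have := congrArg Complex.reLm hsum
    rw [map_multiset_sum] at this
    simpa using this
  have hpos : 0 < (((p.line z).roots.map fun r => 1 / (0 - r)).map Complex.re).sum := by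
    rw [Multiset.map_map]
    obtain ⟨a, ha⟩ := Multiset.exists_mem_of_ne_zero hroots
    obtain ⟨s, hs⟩ := Multiset.exists_cons_of_mem ha
    have key : ∀ r ∈ (p.line z).roots, 0 < (Complex.re ∘ fun r => 1 / (0 - r)) r := by
      intro r hr
      have h := hst.root_re_neg hz hz' hr
      have hr0 : r ≠ 0 := by rintro rfl; simp at h
      simp only [Function.comp, zero_sub, one_div, Complex.inv_re, Complex.neg_re]
      exact div_pos (by linarith) (Complex.normSq_pos.mpr (neg_ne_zero.mpr hr0))
    rw [hs] at key ⊢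
    rw [Multiset.map_cons, Multiset.sum_cons]
    have h1 := key a (by simp)
    have h2 : 0 ≤ (s.map (Complex.re ∘ fun r => 1 / (0 - r))).sum := by
      refine Multiset.sum_nonneg fun x hx => ?_
      obtain ⟨r, hr, rfl⟩ := Multiset.mem_map.mp hx
      exact (key r (by simp [hr])).le
    linarith
  linarith

/-- For a stable homogeneous polynomial, the roots along a positive line are negative reals. -/
theorem MvPolynomial.StronglyStable.root_im_eq_zero (hst : p.StronglyStable)
    (hp : p.IsHomogeneous (n + 1)) {x : Fin (n + 1) → ℝ} (hx : ∀ i, 0 < x i) (hn : 0 < n)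
    {r : ℂ} (hr : r ∈ (p.line fun i => (x i.succ : ℂ)).roots) : r.im = 0 := by
  have hneg : r.re < 0 := hst.root_re_neg (by intro i; simpa using (hx i.succ).le)
    ⟨⟨0, hn⟩, by simpa using hx _⟩ hr
  by_contra him
  have h0 : (p.line fun i => (x i.succ : ℂ)).eval r = 0 := Polynomial.isRoot_of_mem_roots hr
  rw [eval_line] at h0
  -- multiply by a complex number which moves both `1` and `r` to the right half plane
  set a : ℂ := ⟨r.im ^ 2, r.im * (r.re - 1)⟩ with ha
  have hare : 0 < a.re := by simp only [ha]; positivity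
  have har : 0 < (a * r).re := by
    simp only [ha, Complex.mul_re]
    have : 0 < r.im ^ 2 := by positivity
    nlinarith
  refine hst (fun i => a * (Fin.cons r (fun i => (x i.succ : ℂ)) : Fin (n + 1) → ℂ) i) ?_ ?_ ?_
  · intro i
    refine Fin.cases ?_ (fun j => ?_) i
    · simpa using har.le
    · have := mul_pos hare (hx j.succ)
      simpa using this.le
  · exact ⟨0, by simpa using har⟩
  · rw [hp.eval_smul', h0, mul_zero]

/-- Here `s` is the sum of `1/(-r)` over the roots, the logarithmic derivative at `0`. The bound is
`t - r = -r (1 + t/(-r)) ≤ -r exp (t/(-r))`, multiplied over the roots. -/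
theorem Polynomial.norm_eval_le_of_roots_neg {R : Polynomial ℂ}
    (h0 : R.eval 0 ≠ 0) (hre : ∀ r ∈ R.roots, r.re < 0) (him : ∀ r ∈ R.roots, r.im = 0) :
    ∃ s : ℝ, 0 ≤ s ∧ ‖R.derivative.eval 0‖ = ‖R.eval 0‖ * s ∧
      ∀ t : ℝ, 0 ≤ t → ‖R.eval (t : ℂ)‖ ≤ ‖R.eval 0‖ * Real.exp (t * s) := by
  have hsp : R.Splits := IsAlgClosed.splits _
  have hcoe : ∀ r ∈ R.roots, r = ((r.re : ℝ) : ℂ) := fun r hr =>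
    Complex.ext (by simp) (by simpa using him r hr)
  refine ⟨(R.roots.map fun r => 1 / (-r.re)).sum, ?_, ?_, ?_⟩
  · refine Multiset.sum_nonneg fun x hx => ?_
    obtain ⟨r, hr, rfl⟩ := Multiset.mem_map.mp hx
    have := hre r hr
    exact (one_div_pos.mpr (by linarith)).le
  · rw [hsp.eval_derivative_eq_eval_mul_sum h0, norm_mul]
    congr 1
    have : (R.roots.map fun r => 1 / (0 - r)).sum
        = (((R.roots.map fun r => 1 / (-r.re)).sum : ℝ) : ℂ) := by
      rw [← Complex.ofRealHom_eq_coe, map_multiset_sum, Multiset.map_map]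
      refine congrArg _ (Multiset.map_congr rfl fun r hr => ?_)
      rw [Function.comp, Complex.ofRealHom_eq_coe]
      conv_lhs => rw [hcoe r hr]
      push_cast
      ring
    rw [this, Complex.norm_real, Real.norm_of_nonneg]
    refine Multiset.sum_nonneg fun x hx => ?_
    obtain ⟨r, hr, rfl⟩ := Multiset.mem_map.mp hx
    have := hre r hr
    exact (one_div_pos.mpr (by linarith)).le
  · intro t ht
    rw [hsp.eval_eq_prod_roots, hsp.eval_eq_prod_roots, norm_mul, norm_mul, mul_assoc]
    refine mul_le_mul_of_nonneg_left ?_ (norm_nonneg _)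
    have key : ∀ s : Multiset ℂ, (∀ r ∈ s, r.re < 0) → (∀ r ∈ s, r = ((r.re : ℝ) : ℂ)) →
        ‖(s.map fun a => (t : ℂ) - a).prod‖ ≤ ‖(s.map fun a => 0 - a).prod‖ *
          Real.exp (t * (s.map fun r => 1 / (-r.re)).sum) := by
      intro s
      induction s using Multiset.induction_on with
      | empty => simp
      | cons r s ih =>
        intro h1 h2
        have ih' := ih (fun r hr => h1 r (by simp [hr])) (fun r hr => h2 r (by simp [hr]))
        have hr := h1 r (by simp)
        have hr2 := h2 r (by simp)
        simp only [Multiset.map_cons, Multiset.prod_cons, Multiset.sum_cons, norm_mul, mul_add,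
          Real.exp_add]
        have hb : ‖(t : ℂ) - r‖ ≤ ‖0 - r‖ * Real.exp (t * (1 / (-r.re))) := by
          have e1 : ‖(t : ℂ) - r‖ = t + -r.re := by
            rw [hr2, ← Complex.ofReal_sub, Complex.norm_real, Real.norm_of_nonneg]
            · simp [sub_eq_add_neg]
            · simp; linarith
          have e2 : ‖0 - r‖ = -r.re := by
            rw [hr2, zero_sub, norm_neg, Complex.norm_real, Real.norm_of_nonpos] 
            simp; linarith
          rw [e1, e2]
          have h3 := Real.add_one_le_exp (t * (1 / (-r.re)))
          have h4 : 0 < -r.re := by linarith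
          have h5 : -r.re * (1 / -r.re) = 1 := mul_one_div_cancel h4.ne'
          calc t + -r.re = -r.re * (t * (1 / (-r.re)) + 1) := by linear_combination -t * h5
            _ ≤ _ := mul_le_mul_of_nonneg_left h3 h4.le
        calc _ ≤ (‖0 - r‖ * Real.exp (t * (1 / (-r.re)))) *
              (‖(s.map fun a => 0 - a).prod‖ *
                Real.exp (t * (s.map fun r => 1 / (-r.re)).sum)) :=
              mul_le_mul hb ih' (norm_nonneg _) (by positivity)
          _ = _ := by ring
    exact key _ hre hcoe

/-- Gurvits' inequality: the capacity of a stable homogeneous polynomial in `n` variables bounds its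
multilinear coefficient. -/
theorem MvPolynomial.StronglyStable.capacity_le {n : ℕ} {p : MvPolynomial (Fin n) ℂ}
    (hst : p.StronglyStable) (hp : p.IsHomogeneous n) {K : ℝ} (hK : 0 < K)
    (hcap : ∀ x : Fin n → ℝ, (∀ i, 0 < x i) → K * ∏ i, x i ≤ ‖eval (fun i => (x i : ℂ)) p‖) :
    K * Real.exp (-n) ≤ ‖coeff (Finsupp.equivFunOnFinite.symm fun _ => 1) p‖ := by
  induction n generalizing K with
  | zero =>
    have h := hcap (fun _ => 1) (by simp)
    rw [eq_C_of_isEmpty p] at h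
    have e : (Finsupp.equivFunOnFinite.symm fun _ => 1 : Fin 0 →₀ ℕ) = 0 := Subsingleton.elim _ _
    rw [e]
    simpa using h
  | succ n ih =>
    have hq := hp.finSuccEquiv_coeff_isHomogeneous 1 n (by ring)
    have hqs := hst.coeff_one hp
    have hcoef : coeff (Finsupp.equivFunOnFinite.symm fun _ => 1) p =
        coeff (Finsupp.equivFunOnFinite.symm fun _ => 1) ((finSuccEquiv ℂ n p).coeff 1) := by
      rw [finSuccEquiv_coeff_coeff]
      congr 1
      ext i
      refine Fin.cases ?_ (fun j => ?_) i <;> simp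
    rw [hcoef]
    -- Differentiating in one variable and setting it to zero costs a factor `e` in the capacity.
    have := ih hqs hq (K := K * Real.exp (-1)) (by positivity) ?_
    · refine le_trans (le_of_eq ?_) this
      rw [mul_assoc, ← Real.exp_add]
      push_cast
      ring_nf
    intro x hx
    set z : Fin n → ℂ := fun i => (x i : ℂ) with hz
    rw [← derivative_line_eval_zero]
    have hprod : 0 < ∏ i, x i := Finset.prod_pos fun i _ => hx i
    have hline : ∀ t : ℝ, 0 < t → K * (t * ∏ i, x i) ≤ ‖(p.line z).eval (t : ℂ)‖ := by
      intro t ht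
      have h := hcap (Fin.cons t x) (by
        intro i
        refine Fin.cases ?_ (fun j => ?_) i
        · simpa using ht
        · simpa using hx j)
      rw [Fin.prod_univ_succ] at h
      simp only [Fin.cons_zero, Fin.cons_succ] at h
      rw [eval_line]
      convert h using 3
      congr 1
      funext i
      refine Fin.cases ?_ (fun j => ?_) i <;> simp [hz]
    -- With no remaining variable there is no coordinate with positive real part, so the root lemmas
    -- do not apply; homogeneity makes the line a multiple of `X`.
    rcases Nat.eq_zero_or_pos n with rfl | hn
    · have h1 := hline 1 one_pos
      have hX : p.line z = Polynomial.C ((p.line z).coeff 1) * Polynomial.X := by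
        refine Polynomial.funext fun t => ?_
        have h2 : ∀ t : ℂ, (p.line z).eval t = t * (p.line z).eval 1 := by
          intro t
          rw [eval_line, eval_line]
          have : (Fin.cons t z : Fin (0 + 1) → ℂ) =
              fun i => t * (Fin.cons 1 z : Fin (0 + 1) → ℂ) i := by
            funext i
            refine Fin.cases ?_ (fun j => j.elim0) i
            simp
          rw [this, hp.eval_smul']
          simp
        have h3 : p.line z = Polynomial.C ((p.line z).eval 1) * Polynomial.X := by
          refine Polynomial.funext fun t => ?_
          rw [h2 t]; simp only [Polynomial.eval_mul, Polynomial.eval_C, Polynomial.eval_X]; ring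
        have h4 : (p.line z).coeff 1 = (p.line z).eval 1 := by
          conv_lhs => rw [h3]
          simp
        rw [h4, h2 t]; simp only [Polynomial.eval_mul, Polynomial.eval_C, Polynomial.eval_X]; ring
      rw [hX] at h1 ⊢
      have h5 : Real.exp (-1) ≤ 1 := Real.exp_le_one_iff.mpr (by norm_num)
      simp only [Polynomial.derivative_mul, Polynomial.derivative_C, Polynomial.derivative_X] 
      simp at h1 ⊢
      nlinarith
    · have hz0 : ∀ i, 0 ≤ (z i).re := fun i => by simpa [hz] using (hx i).le
      have hz1 : ∃ i, 0 < (z i).re := ⟨⟨0, hn⟩, by simpa [hz] using hx _⟩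
      obtain ⟨s, hs0, hs, hle⟩ := Polynomial.norm_eval_le_of_roots_neg
        (hst.line_eval_zero_ne hz0 hz1) (fun r hr => hst.root_re_neg hz0 hz1 hr)
        (fun r hr => hst.root_im_eq_zero hp (x := Fin.cons 1 x)
          (by
            intro i
            refine Fin.cases ?_ (fun j => ?_) i
            · simp
            · simpa using hx j) hn (by simpa [hz] using hr))
      have hspos : 0 < s := by
        have h1 := hqs z hz0 hz1
        rw [← derivative_line_eval_zero, ← norm_pos_iff, hs] at h1
        exact pos_of_mul_pos_right h1 (norm_nonneg _)
      rw [hs]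
      -- The choice `t = 1/s` minimises `exp (t s) / t`.
      have h1 := (hline (1 / s) (by positivity)).trans (hle (1 / s) (by positivity))
      rw [one_div_mul_cancel hspos.ne'] at h1
      have h2 : K * ∏ i, x i ≤ ‖(p.line z).eval 0‖ * s * Real.exp 1 := by
        have := mul_le_mul_of_nonneg_right h1 hspos.le
        calc K * ∏ i, x i = K * (1 / s * ∏ i, x i) * s := by field_simp
          _ ≤ _ := this
          _ = _ := by ring
      have h3 := mul_le_mul_of_nonneg_right h2 (Real.exp_pos (-1)).le
      have h4 : Real.exp 1 * Real.exp (-1) = 1 := by rw [← Real.exp_add]; simp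
      calc K * Real.exp (-1) * ∏ i, x i = K * (∏ i, x i) * Real.exp (-1) := by ring
        _ ≤ _ := h3
        _ = ‖(p.line z).eval 0‖ * s * (Real.exp 1 * Real.exp (-1)) := by ring
        _ = _ := by rw [h4, mul_one]

end Stable

/-! ### Van der Waerden type bound for permanents. -/

section VanDerWaerden

open MvPolynomial

theorem MvPolynomial.coeff_ones_prod_linear {n : ℕ} (A : Fin n → Fin n → ℂ) :
    coeff (Finsupp.equivFunOnFinite.symm fun _ => 1) (∏ i, ∑ j, C (A i j) * X j) =
      ∑ σ : Equiv.Perm (Fin n), ∏ i, A i (σ i) := by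
  classical
  rw [Finset.prod_univ_sum, coeff_sum, Fintype.piFinset_univ]
  have hterm : ∀ f : Fin n → Fin n, (∏ i, (C (A i (f i)) * X (f i)) : MvPolynomial (Fin n) ℂ) =
      monomial (∑ i, Finsupp.single (f i) 1) (∏ i, A i (f i)) := by
    intro f
    rw [monomial_sum_index, Finset.prod_mul_distrib, map_prod]
    rfl
  have hiff : ∀ f : Fin n → Fin n,
      ((∑ i, Finsupp.single (f i) 1 : Fin n →₀ ℕ) = Finsupp.equivFunOnFinite.symm fun _ => 1) ↔
        Function.Bijective f := by
    intro f
    constructor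
    · intro h
      refine Finite.injective_iff_bijective.mp (Finite.injective_iff_surjective.mpr fun j => ?_)
      have := DFunLike.congr_fun h j
      simp only [Finsupp.coe_finsetSum, Finset.sum_apply, Finsupp.equivFunOnFinite_symm_apply_apply]
        at this
      by_contra! hne
      rw [Finset.sum_eq_zero] at this
      · simp at this
      · intro i _
        exact Finsupp.single_eq_of_ne' (hne i)
    · intro h
      ext j
      simp only [Finsupp.coe_finsetSum, Finset.sum_apply, Finsupp.equivFunOnFinite_symm_apply_apply]
      obtain ⟨i, rfl⟩ := h.2 j
      rw [Finset.sum_eq_single i]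
      · simp
      · intro b _ hb
        exact Finsupp.single_eq_of_ne' (fun h' => hb (h.1 h'))
      · simp
  simp only [hterm, coeff_monomial, hiff]
  rw [← Finset.sum_filter]
  symm
  refine Finset.sum_bij (fun σ _ => (σ : Fin n → Fin n)) ?_ ?_ ?_ ?_
  · intro σ _
    exact Finset.mem_filter.mpr ⟨Finset.mem_univ _, σ.bijective⟩
  · intro σ _ τ _ h
    exact DFunLike.coe_injective h
  · intro f hf
    exact ⟨Equiv.ofBijective f (Finset.mem_filter.mp hf).2, Finset.mem_univ _, rfl⟩
  · intro σ _
    rfl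

/-- The permanent is the multilinear coefficient of the product of the row forms. Positive entries
make this product strongly stable. Weighted AM-GM with weights `A i j / D` bounds each row form
below, and the column sums make every `x j` appear with total exponent `1`, so the capacity is at
least `D ^ n`. -/
theorem permanent_fin_ge {n : ℕ} (A : Fin n → Fin n → ℝ) (hA : ∀ i j, 0 < A i j) {D : ℝ}
    (hD : 0 < D) (hrow : ∀ i, ∑ j, A i j = D) (hcol : ∀ j, ∑ i, A i j = D) :
    (D / Real.exp 1) ^ n ≤ ∑ σ : Equiv.Perm (Fin n), ∏ i, A i (σ i) := by
  set p : MvPolynomial (Fin n) ℂ := ∏ i, ∑ j, C ((A i j : ℝ) : ℂ) * X j with hp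
  have heval : ∀ z : Fin n → ℂ, eval z p = ∏ i, ∑ j, ((A i j : ℝ) : ℂ) * z j := by
    intro z
    simp [hp, map_prod, map_sum]
  have hhom : p.IsHomogeneous n := by
    have := IsHomogeneous.prod Finset.univ
      (fun i => ∑ j, C ((A i j : ℝ) : ℂ) * (X j : MvPolynomial (Fin n) ℂ)) (fun _ => 1)
      (fun i _ => IsHomogeneous.sum _ _ _ fun j _ => isHomogeneous_C_mul_X _ _)
    simpa using this
  have hst : p.StronglyStable := by
    rintro z hz ⟨k, hk⟩
    rw [heval, Finset.prod_ne_zero_iff]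
    intro i _ h0
    have hre : 0 < (∑ j, ((A i j : ℝ) : ℂ) * z j).re := by
      rw [Complex.re_sum]
      simp only [Complex.re_ofReal_mul]
      exact Finset.sum_pos' (fun j _ => mul_nonneg (hA i j).le (hz j))
        ⟨k, Finset.mem_univ _, mul_pos (hA i k) hk⟩
    rw [h0] at hre
    simp at hre
  have hcap : ∀ x : Fin n → ℝ, (∀ i, 0 < x i) →
      D ^ n * ∏ i, x i ≤ ‖eval (fun i => (x i : ℂ)) p‖ := by
    intro x hx
    have e1 : eval (fun i => (x i : ℂ)) p = ((∏ i, ∑ j, A i j * x j : ℝ) : ℂ) := by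
      rw [heval]; push_cast; rfl
    have hsum : ∀ i, 0 ≤ ∑ j, A i j * x j :=
      fun i => Finset.sum_nonneg fun j _ => mul_nonneg (hA i j).le (hx j).le
    rw [e1, Complex.norm_real, Real.norm_of_nonneg (Finset.prod_nonneg fun i _ => hsum i)]
    have hamgm : ∀ i, D * ∏ j, x j ^ (A i j / D) ≤ ∑ j, A i j * x j := by
      intro i
      have h := Real.geom_mean_le_arith_mean_weighted Finset.univ (fun j => A i j / D) x
        (fun j _ => (div_pos (hA i j) hD).le)
        (by rw [← Finset.sum_div, hrow, div_self hD.ne']) (fun j _ => (hx j).le)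
      calc D * ∏ j, x j ^ (A i j / D) ≤ D * ∑ j, A i j / D * x j :=
            mul_le_mul_of_nonneg_left h hD.le
        _ = ∑ j, A i j * x j := by
            rw [Finset.mul_sum]
            refine Finset.sum_congr rfl fun j _ => ?_
            field_simp
    calc D ^ n * ∏ i, x i = ∏ i, (D * ∏ j, x j ^ (A i j / D)) := by
          rw [Finset.prod_mul_distrib, Finset.prod_comm]
          congr 1
          · simp
          · refine Finset.prod_congr rfl fun j _ => ?_
            rw [← Real.rpow_sum_of_pos (hx j), ← Finset.sum_div, hcol, div_self hD.ne',
              Real.rpow_one]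
      _ ≤ _ := Finset.prod_le_prod
          (fun i _ => mul_nonneg hD.le
            (Finset.prod_nonneg fun j _ => Real.rpow_nonneg (hx j).le _)) (fun i _ => hamgm i)
  have h := hst.capacity_le hhom (pow_pos hD n) hcap
  rw [hp, coeff_ones_prod_linear] at h
  have e2 : (∑ σ : Equiv.Perm (Fin n), ∏ i, ((A i (σ i) : ℝ) : ℂ)) =
      ((∑ σ : Equiv.Perm (Fin n), ∏ i, A i (σ i) : ℝ) : ℂ) := by push_cast; rfl
  rw [e2, Complex.norm_real, Real.norm_of_nonneg
    (Finset.sum_nonneg fun σ _ => Finset.prod_nonneg fun i _ => (hA i _).le)] at h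
  rw [div_pow, ← Real.exp_nat_mul, mul_one, div_eq_mul_inv, ← Real.exp_neg]
  exact h

theorem permanent_ge {ι : Type*} [Fintype ι] [DecidableEq ι] (A : ι → ι → ℝ)
    (hA : ∀ i j, 0 < A i j) {D : ℝ}
    (hD : 0 < D) (hrow : ∀ i, ∑ j, A i j = D) (hcol : ∀ j, ∑ i, A i j = D) :
    (D / Real.exp 1) ^ Fintype.card ι ≤ ∑ σ : Equiv.Perm ι, ∏ i, A i (σ i) := by
  let e := Fintype.equivFin ι
  have h := permanent_fin_ge (fun i j => A (e.symm i) (e.symm j)) (fun _ _ => hA _ _) hD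
    (fun i => by rw [← hrow (e.symm i)]; exact Equiv.sum_comp e.symm (fun j => A (e.symm i) j))
    (fun j => by rw [← hcol (e.symm j)]; exact Equiv.sum_comp e.symm (fun i => A i (e.symm j)))
  refine h.trans_eq (Fintype.sum_equiv e.symm.permCongr _ _ fun σ => ?_)
  refine Fintype.prod_equiv e.symm _ _ fun i => ?_
  simp

/-- The van der Waerden type lower bound, for the number of permutations in a regular relation. -/
theorem card_perm_ge {ι : Type*} [Fintype ι] [DecidableEq ι] (r : ι → ι → Prop) [DecidableRel r]
    {d : ℕ} (hd : 0 < d) (hrow : ∀ i, (Finset.univ.filter fun j => r i j).card = d)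
    (hcol : ∀ j, (Finset.univ.filter fun i => r i j).card = d) :
    ((d : ℝ) / Real.exp 1) ^ Fintype.card ι ≤
      ((Finset.univ.filter fun σ : Equiv.Perm ι => ∀ i, r i (σ i)).card : ℝ) := by
  set N : ℝ := (Fintype.card ι : ℝ)
  have hd' : (0 : ℝ) < d := by exact_mod_cast hd
  have hN : 0 ≤ N := Nat.cast_nonneg _
  -- Strong stability needs positive entries, so every entry is raised by `δ`; at the end `δ` tends
  -- to `0` from above.
  have key : ∀ δ : ℝ, 0 < δ → ((d : ℝ) / Real.exp 1) ^ Fintype.card ι ≤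
      ∑ σ : Equiv.Perm ι, ∏ i, ((if r i (σ i) then (1 : ℝ) else 0) + δ) := by
    intro δ hδ
    have h := permanent_ge (fun i j => (if r i j then (1 : ℝ) else 0) + δ)
      (fun i j => by split_ifs <;> linarith) (D := d + N * δ) (by positivity)
      (fun i => by
        rw [Finset.sum_add_distrib, Finset.sum_boole, hrow]; simp [N])
      (fun j => by
        rw [Finset.sum_add_distrib, Finset.sum_boole, hcol]; simp [N])
    refine le_trans ?_ h
    gcongr
    nlinarith
  have hcont : Continuous fun δ : ℝ =>
      ∑ σ : Equiv.Perm ι, ∏ i, ((if r i (σ i) then (1 : ℝ) else 0) + δ) := by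
    fun_prop
  have hlim := (hcont.tendsto 0).mono_left (nhdsWithin_le_nhds (s := Set.Ioi 0))
  have h0 := ge_of_tendsto hlim (by
    filter_upwards [self_mem_nhdsWithin] with δ hδ using key δ hδ)
  refine h0.trans_eq ?_
  simp only [add_zero]
  rw [Finset.card_filter]
  push_cast
  refine Finset.sum_congr rfl fun σ _ => ?_
  rw [Finset.prod_boole]
  simp

end VanDerWaerden

/-! ### Brégman's theorem, by Schrijver's argument. -/

section Bregman

open Finset

open scoped Classical

/-- The bijections contained in a relation. -/
noncomputable def bijectionsIn {α β : Type*} [Fintype α] [Fintype β] (r : α → β → Prop) :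
    Finset (α ≃ β) :=
  univ.filter fun e => ∀ a, r a (e a)

/-- The number of elements related to `a`. -/
noncomputable def relDegree {α β : Type*} [Fintype β] (r : α → β → Prop) (a : α) : ℕ :=
  (univ.filter fun b => r a b).card

theorem mem_bijectionsIn {α β : Type*} [Fintype α] [Fintype β] {r : α → β → Prop} {e : α ≃ β} :
    e ∈ bijectionsIn r ↔ ∀ a, r a (e a) := by
  simp [bijectionsIn]

theorem card_bijectionsIn_apply_eq {α β : Type*} [Fintype α] [Fintype β] (r : α → β → Prop) {a₀ : α} {b₀ : β}
    (h : r a₀ b₀) :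
    ((bijectionsIn r).filter fun e => e a₀ = b₀).card =
      (bijectionsIn fun (x : {x // x ≠ a₀}) (y : {y // y ≠ b₀}) => r x y).card := by
  refine card_bij (fun e he => e.subtypeEquiv fun a => ?_) ?_ ?_ ?_
  · rw [← (mem_filter.mp he).2]
    simp
  · intro e he
    rw [mem_bijectionsIn]
    intro x
    exact mem_bijectionsIn.mp (mem_filter.mp he).1 x
  · intro e he e' he' heq
    ext x
    by_cases hx : x = a₀
    · rw [hx, (mem_filter.mp he).2, (mem_filter.mp he').2]
    · have := congrArg (fun f => ((f ⟨x, hx⟩ : {y // y ≠ b₀}) : β)) heq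
      simpa using this
  · intro f hf
    let e : α ≃ β := (Equiv.optionSubtypeNe a₀).symm.trans
      (f.optionCongr.trans (Equiv.optionSubtypeNe b₀))
    have he0 : e a₀ = b₀ := by simp [e]
    have he : ∀ x : {x // x ≠ a₀}, e x = f x := by
      intro x
      simp [e, Equiv.optionSubtypeNe_symm_of_ne x.2]
    refine ⟨e, mem_filter.mpr ⟨mem_bijectionsIn.mpr fun x => ?_, he0⟩, ?_⟩
    · by_cases hx : x = a₀
      · rw [hx, he0]; exact h
      · have h1 := mem_bijectionsIn.mp hf ⟨x, hx⟩
        rw [← he] at h1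
        exact h1
    · ext x
      simp [he]

/-- Jensen's inequality for the convex function `x log x` with equal weights. -/
theorem mul_log_sum_le {ι : Type*} (s : Finset ι) (t : ι → ℝ) (ht : ∀ i ∈ s, 0 ≤ t i) :
    (∑ i ∈ s, t i) * Real.log (∑ i ∈ s, t i) ≤
      ∑ i ∈ s, t i * Real.log (t i) + (∑ i ∈ s, t i) * Real.log s.card := by
  rcases s.eq_empty_or_nonempty with rfl | hs
  · simp
  have hk : (0 : ℝ) < s.card := by exact_mod_cast hs.card_pos
  rcases (sum_nonneg ht).eq_or_lt with h0 | h0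
  · have hz : ∀ i ∈ s, t i = 0 := (sum_eq_zero_iff_of_nonneg ht).mp h0.symm
    rw [← h0, sum_eq_zero fun i hi => by rw [hz i hi, zero_mul]]
    simp
  have h := Real.convexOn_mul_log.map_sum_le (t := s) (w := fun _ => (1 : ℝ) / s.card) (p := t)
    (fun _ _ => by positivity) (by simp [hk.ne']) (fun i hi => ht i hi)
  simp only [smul_eq_mul, ← mul_sum] at h
  rw [Real.log_mul (by positivity) h0.ne', one_div, Real.log_inv] at h
  have h2 := mul_le_mul_of_nonneg_left h hk.le
  field_simp at h2
  linarith

/-- The exponent in Brégman's theorem. -/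
noncomputable def bregmanWeight (k : ℕ) : ℝ := Real.log (k.factorial) / k

theorem bregmanWeight_nonneg (k : ℕ) : 0 ≤ bregmanWeight k :=
  div_nonneg (Real.log_natCast_nonneg _) (Nat.cast_nonneg _)

theorem mul_bregmanWeight (k : ℕ) : k * bregmanWeight k = Real.log k.factorial := by
  rcases Nat.eq_zero_or_pos k with rfl | hk
  · simp
  · rw [bregmanWeight, mul_div_cancel₀]
    exact_mod_cast hk.ne'

theorem relDegree_minor {α β : Type*} [Fintype β] (r : α → β → Prop) (a₀ : α) (b₀ : β) (x : {x // x ≠ a₀}) :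
    relDegree (fun (x : {x // x ≠ a₀}) (y : {y // y ≠ b₀}) => r x y) x =
      if r x b₀ then relDegree r x - 1 else relDegree r x := by
  have h : relDegree (fun (x : {x // x ≠ a₀}) (y : {y // y ≠ b₀}) => r x y) x =
      ((univ.filter fun b => r x b).erase b₀).card := by
    rw [relDegree]
    refine card_bij (fun y _ => (y : β)) ?_ ?_ ?_
    · intro y hy
      simpa [y.2] using hy
    · intro y _ y' _ h
      exact Subtype.ext h
    · intro y hy
      simp only [mem_erase, mem_filter, mem_univ, true_and] at hy
      exact ⟨⟨y, hy.1⟩, by simpa using hy.2, rfl⟩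
  rw [h]
  split_ifs with hr
  · rw [card_erase_of_mem (by simpa using hr), relDegree]
  · rw [erase_eq_of_notMem (by simpa using hr), relDegree]

/-- **Brégman's theorem**, in logarithmic form. -/
theorem log_card_bijectionsIn_le.{u} {α β : Type u} [Fintype α] [Fintype β] (r : α → β → Prop) :
    Real.log (bijectionsIn r).card ≤ ∑ a, bregmanWeight (relDegree r a) := by
  induction hn : Fintype.card α generalizing α β with
  | zero =>
    have : IsEmpty α := Fintype.card_eq_zero_iff.mp hn
    have h1 : (bijectionsIn r).card ≤ 1 :=
      card_le_one.mpr fun e _ e' _ => Equiv.ext fun x => isEmptyElim x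
    have h2 : Real.log (bijectionsIn r).card ≤ 0 :=
      Real.log_nonpos (Nat.cast_nonneg _) (by exact_mod_cast h1)
    simpa using h2
  | succ m ih =>
    set S := bijectionsIn r with hS
    rcases S.eq_empty_or_nonempty with h0 | hne
    · rw [h0]
      simpa using sum_nonneg fun a _ => bregmanWeight_nonneg _
    have hP : (0 : ℝ) < S.card := by exact_mod_cast hne.card_pos
    -- When `r a b` holds, `P a b` is the number of bijections in the minor without `a` and `b`, to
    -- which the induction hypothesis applies.
    let P : α → β → ℝ := fun a b => ((S.filter fun e => e a = b).card : ℝ)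
    have hsum : ∀ a, ∑ b ∈ univ.filter (fun b => r a b), P a b = S.card := by
      intro a
      rw [card_eq_sum_card_fiberwise (f := fun e => e a) (t := univ.filter fun b => r a b)]
      · push_cast; rfl
      · intro e he
        simpa using mem_bijectionsIn.mp he a
    -- Jensen along row `a`; grouping `S` by the value at `a` turns the sum of `P log P` into a sum
    -- over bijections.
    have hrow : ∀ a, (S.card : ℝ) * Real.log S.card ≤
        ∑ e ∈ S, Real.log (P a (e a)) + S.card * Real.log (relDegree r a) := by
      intro a
      have h := mul_log_sum_le (univ.filter fun b => r a b) (P a) (fun _ _ => Nat.cast_nonneg _)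
      rw [hsum a] at h
      have hfib : ∑ b ∈ univ.filter (fun b => r a b), P a b * Real.log (P a b) =
          ∑ e ∈ S, Real.log (P a (e a)) := by
        rw [← sum_fiberwise_of_maps_to (s := S) (t := univ.filter fun b => r a b)
          (g := fun e => e a)]
        · refine sum_congr rfl fun b _ => ?_
          rw [sum_congr rfl (g := fun _ => Real.log (P a b))]
          · rw [sum_const, nsmul_eq_mul]
          · intro e he
            rw [(mem_filter.mp he).2]
        · intro e he
          simpa using mem_bijectionsIn.mp he a
      rw [hfib] at h
      refine h.trans_eq ?_
      rw [relDegree]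
    have hminor : ∀ e ∈ S, ∀ a, Real.log (P a (e a)) ≤
        ∑ x ∈ univ.filter (fun x => x ≠ a),
          if r x (e a) then bregmanWeight (relDegree r x - 1) else bregmanWeight (relDegree r x) := by
      intro e he a
      have hcard : Fintype.card {x // x ≠ a} = m := by
        rw [Fintype.card_subtype_compl, Fintype.card_subtype_eq, hn]; rfl
      have h := ih (fun (x : {x // x ≠ a}) (y : {y // y ≠ e a}) => r x y) hcard
      simp only [P]
      rw [hS, card_bijectionsIn_apply_eq r (mem_bijectionsIn.mp he a)]
      refine h.trans_eq ?_
      rw [sum_subtype (p := fun x => x ≠ a) (univ.filter fun x => x ≠ a) (by simp)]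
      refine sum_congr (by congr!) fun x _ => ?_
      rw [relDegree_minor]
      split_ifs <;> rfl
    -- Fix `e` and let `a` range over all elements other than `x`. Deleting the pair `(a, e a)`
    -- lowers the degree of `x` for exactly `relDegree r x - 1` of them, since `x` itself is one of
    -- the elements with `r x (e a)`.
    have hdeg : ∀ e ∈ S, ∑ a, Real.log (P a (e a)) ≤
        ∑ x, ((relDegree r x - 1 : ℕ) * bregmanWeight (relDegree r x - 1) +
          ((m + 1 : ℝ) - relDegree r x) * bregmanWeight (relDegree r x)) := by
      intro e he
      refine (sum_le_sum fun a _ => hminor e he a).trans_eq ?_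
      simp only [sum_filter]
      rw [sum_comm]
      refine sum_congr rfl fun x _ => ?_
      have hcard : (univ.filter fun a => r x (e a)).card = relDegree r x := by
        rw [relDegree]
        refine card_bij (fun a _ => e a) (fun a ha => by simpa using ha)
          (fun a _ a' _ h => e.injective h) fun b hb => ⟨e.symm b, by simpa using hb, by simp⟩
      have hx : r x (e x) := mem_bijectionsIn.mp he x
      have hpos : 1 ≤ relDegree r x := by
        rw [← hcard]; exact card_pos.mpr ⟨x, by simpa using hx⟩
      rw [← sum_filter, ← sum_filter_add_sum_filter_not _ (fun a => r x (e a))]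
      have c1 : ((univ.filter fun a => x ≠ a).filter fun a => r x (e a)).card
          = relDegree r x - 1 := by
        rw [← hcard, ← card_erase_of_mem (a := x) (by simpa using hx)]
        congr 1
        ext a
        simp [eq_comm]
      have c2 : (((univ.filter fun a => x ≠ a).filter fun a => ¬ r x (e a)).card : ℝ)
          = (m + 1 : ℝ) - relDegree r x := by
        have h1 := card_filter_add_card_filter_not (s := (univ : Finset α)) (fun a => r x (e a))
        rw [hcard, card_univ, hn] at h1
        have h2 : ((univ.filter fun a => x ≠ a).filter fun a => ¬ r x (e a)) =
            univ.filter fun a => ¬ r x (e a) := by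
          ext a
          simp only [mem_filter, mem_univ, true_and, and_iff_right_iff_imp]
          rintro h rfl
          exact h hx
        rw [h2, eq_sub_iff_add_eq]
        have h3 : ((relDegree r x + (univ.filter fun a => ¬ r x (e a)).card : ℕ) : ℝ) = 
          ((m + 1 : ℕ) : ℝ) := by rw [h1]
        push_cast at h3
        linarith
      rw [sum_congr rfl (g := fun _ => bregmanWeight (relDegree r x - 1)), sum_const, c1,
        nsmul_eq_mul, sum_congr rfl (g := fun _ => bregmanWeight (relDegree r x)), sum_const,
        nsmul_eq_mul, c2]
      · intro a ha
        rw [if_neg (mem_filter.mp ha).2]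
      · intro a ha
        rw [if_pos (mem_filter.mp ha).2]
    have htot := sum_le_sum (s := univ) fun a _ => hrow a
    rw [sum_const, card_univ, hn, sum_add_distrib, sum_comm, ← mul_sum, nsmul_eq_mul] at htot
    have hbound := sum_le_sum hdeg
    rw [sum_const, nsmul_eq_mul] at hbound
    -- For degree `k`, `log (k-1)! + log k = log k! = k * bregmanWeight k`, so each `x` contributes
    -- exactly `m + 1` times its weight.
    have hfinal : ∑ x, ((relDegree r x - 1 : ℕ) * bregmanWeight (relDegree r x - 1) +
          ((m + 1 : ℝ) - relDegree r x) * bregmanWeight (relDegree r x)) +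
          ∑ a, Real.log (relDegree r a) = (m + 1) * ∑ a, bregmanWeight (relDegree r a) := by
      rw [← sum_add_distrib, mul_sum]
      refine sum_congr rfl fun x _ => ?_
      have hpos : relDegree r x ≠ 0 := by
        obtain ⟨e, he⟩ := hne
        rw [relDegree]
        exact (card_pos.mpr ⟨e x, by simpa using mem_bijectionsIn.mp he x⟩).ne'
      obtain ⟨k, hk⟩ := Nat.exists_eq_succ_of_ne_zero hpos
      have h1 := mul_bregmanWeight (relDegree r x)
      rw [mul_bregmanWeight, sub_mul, h1, hk]
      simp only [Nat.succ_eq_add_one, Nat.add_sub_cancel]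
      rw [Nat.factorial_succ]
      push_cast
      rw [Real.log_mul (by positivity) (by positivity)]
      ring
    push_cast at htot
    have : (m + 1 : ℝ) * (S.card * Real.log S.card) ≤
        S.card * ((m + 1) * ∑ a, bregmanWeight (relDegree r a)) := by
      rw [← hfinal]
      linarith
    have h4 : ((m + 1 : ℝ) * S.card) * Real.log S.card ≤
        ((m + 1) * S.card) * ∑ a, bregmanWeight (relDegree r a) := by linarith
    exact le_of_mul_le_mul_left h4 (by positivity)

end Bregman

/-! ### Stirling-type estimates for Brégman's weights. -/

theorem Real.log_factorial_le {r : ℕ} (hr : 1 ≤ r) :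
    Real.log r.factorial ≤ r * Real.log r - r + 1 + Real.log r := by
  induction r, hr using Nat.le_induction with
  | base => simp
  | succ r hr ih =>
    have hr0 : (0 : ℝ) < r := by exact_mod_cast hr
    rw [Nat.factorial_succ]
    push_cast
    rw [Real.log_mul (by positivity) (by positivity)]
    have h := Real.one_sub_inv_le_log_of_pos (x := ((r : ℝ) + 1) / r) (by positivity)
    rw [Real.log_div (by positivity) hr0.ne', inv_div] at h
    have h2 := mul_le_mul_of_nonneg_left h (show (0 : ℝ) ≤ r + 1 by positivity)
    have h3 : ((r : ℝ) + 1) * (1 - r / (r + 1)) = 1 := by field_simp; ring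
    rw [h3] at h2
    linarith

theorem bregmanWeight_le {r : ℕ} (hr : 1 ≤ r) :
    bregmanWeight r ≤ Real.log r - 1 + (1 + Real.log r) / r := by
  have hr0 : (0 : ℝ) < r := by exact_mod_cast hr
  rw [bregmanWeight, div_le_iff₀ hr0]
  have h : (Real.log r - 1 + (1 + Real.log r) / r) * r = r * Real.log r - r + 1 + Real.log r := by
    field_simp; ring
  rw [h]
  exact Real.log_factorial_le hr

/-! ### Neighbour permutations with a prescribed fixed set. -/

namespace SimpleGraph

open Finset

variable {V : Type*} [Fintype V] [DecidableEq V] (G : SimpleGraph V) [DecidableRel G.Adj]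

/-- The permutations which fix `S` pointwise and move each other vertex to a neighbour. -/
def adjPerms (S : Finset V) : Finset (Equiv.Perm V) :=
  univ.filter fun σ => (∀ v ∈ S, σ v = v) ∧ ∀ v ∉ S, G.Adj v (σ v)

variable {G} {S : Finset V} {σ : Equiv.Perm V} {d : ℕ}

theorem mem_adjPerms : σ ∈ G.adjPerms S ↔ (∀ v ∈ S, σ v = v) ∧ ∀ v ∉ S, G.Adj v (σ v) := by
  simp [adjPerms]

theorem apply_notMem_of_mem_adjPerms (hσ : σ ∈ G.adjPerms S) {v : V} (hv : v ∉ S) : σ v ∉ S := by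
  intro h
  have h1 := (mem_adjPerms.mp hσ).1 _ h
  rw [σ.injective h1] at h
  exact hv h

/-- Brégman's theorem for the relation allowing only `v` at `v ∈ S`, a row of weight `log 1! = 0`,
and only neighbours outside `S` at the other vertices. -/
theorem log_card_adjPerms_le_sum :
    Real.log (G.adjPerms S).card ≤
      ∑ v ∈ Sᶜ, bregmanWeight (G.neighborFinset v \ S).card := by
  classical
  set r : V → V → Prop := fun v w => if v ∈ S then w = v else G.Adj v w ∧ w ∉ S with hr
  have h1 : (G.adjPerms S).card ≤ (bijectionsIn r).card := by
    refine card_le_card fun σ hσ => mem_bijectionsIn.mpr fun v => ?_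
    simp only [hr]
    split_ifs with hv
    · exact (mem_adjPerms.mp hσ).1 v hv
    · exact ⟨(mem_adjPerms.mp hσ).2 v hv, apply_notMem_of_mem_adjPerms hσ hv⟩
  have h2 : Real.log (G.adjPerms S).card ≤ Real.log (bijectionsIn r).card := by
    rcases Nat.eq_zero_or_pos (G.adjPerms S).card with h0 | h0
    · rw [h0]
      simpa using Real.log_natCast_nonneg _
    · exact Real.log_le_log (by exact_mod_cast h0) (by exact_mod_cast h1)
  refine h2.trans ((log_card_bijectionsIn_le r).trans_eq ?_)
  rw [← sum_compl_add_sum S, add_eq_left.mpr]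
  · refine sum_congr rfl fun v hv => ?_
    congr 1
    rw [relDegree]
    congr 1
    ext w
    simp [hr, mem_compl.mp hv]
  · refine sum_eq_zero fun v hv => ?_
    have : relDegree r v = 1 := by
      rw [relDegree, card_eq_one]
      exact ⟨v, by ext w; simp [hr, hv]⟩
    simp [this, bregmanWeight]

/-- Double counting of the edges leaving `S`: each vertex of `S` has at least `d - |S|` neighbours
outside. -/
theorem sum_card_neighborFinset_inter_ge (hG : G.IsRegularOfDegree d) :
    (S.card : ℝ) * (d - S.card) ≤ ∑ v ∈ Sᶜ, ((G.neighborFinset v ∩ S).card : ℝ) := by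
  have hswap : ∑ v ∈ Sᶜ, (G.neighborFinset v ∩ S).card =
      ∑ u ∈ S, (G.neighborFinset u \ S).card := by
    have e1 : ∀ v, (G.neighborFinset v ∩ S).card = ∑ u ∈ S, if G.Adj v u then 1 else 0 := by
      intro v
      rw [← card_filter]
      congr 1
      ext u
      simp [and_comm]
    have e2 : ∀ u, (G.neighborFinset u \ S).card = ∑ v ∈ Sᶜ, if G.Adj v u then 1 else 0 := by
      intro v
      rw [← card_filter]
      congr 1
      ext u
      simp [and_comm, G.adj_comm]
    simp only [e1, e2]
    exact sum_comm
  have hge : ∀ u ∈ S, (d : ℝ) - S.card ≤ ((G.neighborFinset u \ S).card : ℝ) := by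
    intro u _
    have h := le_card_sdiff S (G.neighborFinset u)
    rw [card_neighborFinset_eq_degree, hG u] at h
    have h' : d ≤ (G.neighborFinset u \ S).card + S.card := by omega
    have : (d : ℝ) ≤ (G.neighborFinset u \ S).card + S.card := by exact_mod_cast h'
    linarith
  rw [← Nat.cast_sum, hswap, Nat.cast_sum, ← nsmul_eq_mul]
  exact card_nsmul_le_sum _ _ _ hge

/-- Dropping `|S|` rows loses `|S|` terms `log d - 1`. The `-1`s are recovered from the reduced
degrees: `log (d - s) ≤ log d - s/d`, and by double counting the `s/d` add up to at least `|S| -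
|S|^2/d ≥ |S| - 1`. The reduced degrees are at least `n/4`, so the Stirling errors total at most `4
(1 + log n)`. -/
theorem log_card_adjPerms_le [hV : Nonempty V] (hG : G.IsRegularOfDegree d) (hd : 0 < d)
    (hn : Fintype.card V ≤ 2 * d) (hS : 2 * S.card ≤ d) (hS2 : S.card ^ 2 ≤ d) :
    Real.log (G.adjPerms S).card ≤ ((Fintype.card V : ℝ) - S.card) * Real.log d -
      Fintype.card V + 5 + 4 * Real.log (Fintype.card V) := by
  have hd0 : (0 : ℝ) < d := by exact_mod_cast hd
  have hdn : d ≤ Fintype.card V := by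
    obtain ⟨v⟩ := hV
    rw [← hG v]; exact (G.degree_lt_card_verts v).le
  have hn0 : (0 : ℝ) < Fintype.card V := by exact_mod_cast hd.trans_le hdn
  have hterm : ∀ v ∈ Sᶜ, bregmanWeight (G.neighborFinset v \ S).card ≤
      (Real.log d - 1 + 4 * (1 + Real.log (Fintype.card V)) / Fintype.card V) -
        ((G.neighborFinset v ∩ S).card : ℝ) / d := by
    intro v _
    have hadd := card_sdiff_add_card_inter (G.neighborFinset v) S
    rw [card_neighborFinset_eq_degree, hG v] at hadd
    set r := (G.neighborFinset v \ S).card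
    set s := (G.neighborFinset v ∩ S).card with hs
    have hsle : s ≤ S.card := card_le_card inter_subset_right
    have hr1 : 1 ≤ r := by omega
    have hr0 : (0 : ℝ) < r := by exact_mod_cast hr1
    have hrn : Fintype.card V ≤ 4 * r := by omega
    have haddR : (r : ℝ) + s = d := by exact_mod_cast hadd
    refine (bregmanWeight_le hr1).trans ?_
    have h1 : Real.log r ≤ Real.log d - s / d := by
      have h := Real.log_le_sub_one_of_pos (x := (r : ℝ) / d) (by positivity)
      rw [Real.log_div hr0.ne' hd0.ne'] at h
      have : (r : ℝ) / d - 1 = - (s / d) := by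
        rw [← haddR]; field_simp; ring
      linarith
    have h2 : (1 + Real.log r) / r ≤ 4 * (1 + Real.log (Fintype.card V)) / Fintype.card V := by
      rw [div_le_div_iff₀ hr0 hn0]
      have h3 : Real.log r ≤ Real.log (Fintype.card V) :=
        Real.log_le_log hr0 (by exact_mod_cast (by omega : r ≤ Fintype.card V))
      have h4 : 0 ≤ Real.log r := Real.log_natCast_nonneg _
      have h5 : (Fintype.card V : ℝ) ≤ 4 * r := by exact_mod_cast hrn
      nlinarith [mul_le_mul (add_le_add_right h3 1) h5 hn0.le (by linarith)]
    linarith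
  refine log_card_adjPerms_le_sum.trans ((sum_le_sum hterm).trans ?_)
  rw [sum_sub_distrib, sum_const, nsmul_eq_mul, card_compl, Nat.cast_sub (card_le_univ _),
    ← sum_div]
  have hsum := sum_card_neighborFinset_inter_ge (S := S) hG
  have h1 : (S.card : ℝ) - 1 ≤ (∑ v ∈ Sᶜ, ((G.neighborFinset v ∩ S).card : ℝ)) / d := by
    rw [le_div_iff₀ hd0]
    have : (S.card : ℝ) ^ 2 ≤ d := by exact_mod_cast hS2
    nlinarith
  have h2 : ((Fintype.card V : ℝ) - S.card) *
      (4 * (1 + Real.log (Fintype.card V)) / Fintype.card V) ≤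
      4 * (1 + Real.log (Fintype.card V)) := by
    rw [mul_div_assoc', div_le_iff₀ hn0, mul_comm]
    refine mul_le_mul_of_nonneg_left ?_ ?_
    · have : (0 : ℝ) ≤ S.card := Nat.cast_nonneg _
      linarith
    · have := Real.log_natCast_nonneg (Fintype.card V)
      positivity
  linarith

theorem card_adjPerms_mul_le (hG : G.IsRegularOfDegree d) (hd : 0 < d)
    (hn : Fintype.card V ≤ 2 * d) (hV : 0 < Fintype.card V)
    (hS : 2 * S.card ≤ d) (hS2 : S.card ^ 2 ≤ d) :
    ((G.adjPerms S).card : ℝ) * d ^ S.card ≤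
      (d / Real.exp 1) ^ Fintype.card V * (Real.exp 5 * Fintype.card V ^ 4) := by
  have hd0 : (0 : ℝ) < d := by exact_mod_cast hd
  have hn0 : (0 : ℝ) < Fintype.card V := by exact_mod_cast hV
  rcases Nat.eq_zero_or_pos (G.adjPerms S).card with h0 | h0
  · rw [h0]; simp; positivity
  have h0' : (0 : ℝ) < (G.adjPerms S).card := by exact_mod_cast h0
  rw [← Real.log_le_log_iff (by positivity) (by positivity)]
  rw [Real.log_mul (by positivity) (by positivity), Real.log_mul (by positivity) (by positivity),
    Real.log_mul (by positivity) (by positivity), Real.log_pow, Real.log_pow, Real.log_pow,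
    Real.log_div (by positivity) (by positivity), Real.log_exp, Real.log_exp]
  have : Nonempty V := Fintype.card_pos_iff.mp hV
  have := log_card_adjPerms_le hG hd hn hS hS2
  push_cast
  linarith

end SimpleGraph

namespace SimpleGraph

open Finset Equiv.Perm

/-! ### Few permutations have many short cycles. -/

section Peeling

variable {V : Type*} [Fintype V] [DecidableEq V] (G : SimpleGraph V) [DecidableRel G.Adj]

/-- The vertex lists of the walks of length `k` starting at a given vertex. -/
def walkLists : ℕ → V → Finset (List V)
  | 0, v => {[v]}
  | k + 1, v => (G.neighborFinset v).biUnion fun u => (walkLists k u).image (List.cons v)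

variable {G} {S : Finset V} {σ : Equiv.Perm V} {d : ℕ}

theorem card_walkLists_le (hG : G.IsRegularOfDegree d) (k : ℕ) (v : V) :
    (G.walkLists k v).card ≤ d ^ k := by
  induction k generalizing v with
  | zero => simp [walkLists]
  | succ k ih =>
    rw [walkLists, pow_succ']
    refine card_biUnion_le.trans ?_
    rw [← hG v, ← card_neighborFinset_eq_degree, ← smul_eq_mul]
    refine sum_le_card_nsmul _ _ _ fun u _ => card_image_le.trans ?_
    rw [card_neighborFinset_eq_degree, hG v]
    exact ih u

theorem iterate_mem_walkLists (hσ : σ ∈ G.adjPerms S) (k : ℕ) {v : V} (hv : v ∉ S) :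
    List.iterate σ v (k + 1) ∈ G.walkLists k v := by
  induction k generalizing v with
  | zero => simp [walkLists]
  | succ k ih =>
    rw [List.iterate, walkLists]
    refine mem_biUnion.mpr ⟨σ v, ?_, mem_image_of_mem _ (ih (apply_notMem_of_mem_adjPerms hσ hv))⟩
    rw [mem_neighborFinset]
    exact (mem_adjPerms.mp hσ).2 v hv

variable (G) in
/-- The permutations in `G.adjPerms S` for which the vertices in `t` lie on distinct cycles of
length at most `l`. -/
def markedPerms (S : Finset V) (l : ℕ) (t : List V) : Finset (Equiv.Perm V) :=
  (G.adjPerms S).filter fun σ =>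
    (t.map σ.cycleOf).Nodup ∧ ∀ v ∈ t, v ∉ S ∧ (σ.cycleOf v).support.card ≤ l

theorem toFinset_toList (σ : Equiv.Perm V) (v : V) :
    (σ.toList v).toFinset = (σ.cycleOf v).support := by
  ext y
  rw [List.mem_toFinset, mem_toList_iff, mem_support_cycleOf_iff]

theorem card_union_toList (hσ : σ ∈ G.adjPerms S) (v : V) :
    (S ∪ (σ.toList v).toFinset).card = S.card + (σ.cycleOf v).support.card := by
  rw [toFinset_toList, card_union_of_disjoint]
  rw [disjoint_right]
  intro y hy hyS
  exact Equiv.Perm.mem_support.mp (support_cycleOf_le σ v hy) ((mem_adjPerms.mp hσ).1 y hyS)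

/-- Dividing by the cycle through `v` freezes its vertices and leaves all other cycles unchanged;
the vertices of `t` lie on other cycles. -/
theorem mul_inv_cycleOf_mem_markedPerms {l : ℕ} {v : V} {t : List V}
    (hσ : σ ∈ G.markedPerms S l (v :: t)) :
    σ * (σ.cycleOf v)⁻¹ ∈ G.markedPerms (S ∪ (σ.toList v).toFinset) l t := by
  obtain ⟨hσS, hnd, ht⟩ := mem_filter.mp hσ
  obtain ⟨hfix, hadj⟩ := mem_adjPerms.mp hσS
  have hvS := (ht v (by simp)).1
  have hv : v ∈ σ.support := by
    rw [Equiv.Perm.mem_support]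
    exact (hadj v hvS).ne'
  set c := σ.cycleOf v with hc
  have hcmem : c ∈ σ.cycleFactorsFinset := cycleOf_mem_cycleFactorsFinset_iff.mpr hv
  have hdisj := disjoint_mul_inv_of_mem_cycleFactorsFinset hcmem
  have happ : ∀ y, y ∉ c.support → (σ * c⁻¹) y = σ y := by
    intro y hy
    rw [mul_apply, inv_eq_iff_eq.mpr (Equiv.Perm.notMem_support.mp hy).symm]
  have happ' : ∀ y, y ∈ c.support → (σ * c⁻¹) y = y := by
    intro y hy
    exact (hdisj y).resolve_right (Equiv.Perm.mem_support.mp hy)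
  have hSc : ∀ y ∈ S, y ∉ c.support := fun y hy hyc =>
    Equiv.Perm.mem_support.mp (support_cycleOf_le σ v hyc) (hfix y hy)
  have htc : ∀ u ∈ t, u ∉ c.support := by
    intro u hu huc
    rw [List.map_cons, List.nodup_cons] at hnd
    exact hnd.1 (List.mem_map.mpr ⟨u, hu, (cycle_is_cycleOf huc hcmem).symm⟩)
  have hcyc : ∀ u ∈ t, (σ * c⁻¹).cycleOf u = σ.cycleOf u := by
    intro u hu
    have h := cycleOf_mul_of_apply_right_eq_self hdisj.commute u (Equiv.Perm.notMem_support.mp (htc u hu))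
    rw [inv_mul_cancel_right] at h
    exact h.symm
  rw [toFinset_toList, ← hc]
  refine mem_filter.mpr ⟨mem_adjPerms.mpr ⟨fun y hy => ?_, fun y hy => ?_⟩, ?_, fun u hu => ?_⟩
  · rcases mem_union.mp hy with h | h
    · rw [happ y (hSc y h), hfix y h]
    · exact happ' y h
  · rw [mem_union, not_or] at hy
    rw [happ y hy.2]
    exact hadj y hy.1
  · rw [List.map_congr_left hcyc]
    rw [List.map_cons, List.nodup_cons] at hnd
    exact hnd.2
  · rw [hcyc u hu, mem_union, not_or]
    have := ht u (by simp [hu])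
    exact ⟨⟨this.1, htc u hu⟩, this.2⟩

/-- The permutation is determined by the vertex list of the cycle through `v` and by what remains
after removing it. A list of `k + 1` vertices comes from a walk with `k` steps, at most `d ^ k`
choices, while freezing `k + 1` more vertices saves `d ^ (k + 1)`: the net gain is one factor `d`.
-/
theorem card_markedPerms_filter_le {l k : ℕ} {v : V} {t : List V} {B : ℝ} (hd : 0 < d)
    (hG : G.IsRegularOfDegree d) (hB0 : 0 ≤ B)
    (hB : ∀ T : Finset V, T.card = S.card + (k + 1) →
      ((G.markedPerms T l t).card : ℝ) * d ^ (T.card + t.length) ≤ B) :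
    (((G.markedPerms S l (v :: t)).filter fun σ => (σ.cycleOf v).support.card = k + 1).card : ℝ) *
      d ^ (S.card + (v :: t).length) ≤ B := by
  have hd0 : (0 : ℝ) < d := by exact_mod_cast hd
  set W := (G.walkLists k v).filter fun L => (S ∪ L.toFinset).card = S.card + (k + 1) with hW
  have hle : ((G.markedPerms S l (v :: t)).filter
      fun σ => (σ.cycleOf v).support.card = k + 1).card ≤
      (W.sigma fun L => G.markedPerms (S ∪ L.toFinset) l t).card := by
    refine card_le_card_of_injOn (fun σ => ⟨σ.toList v, σ * (σ.cycleOf v)⁻¹⟩) ?_ ?_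
    · intro σ hσ
      obtain ⟨hσ, hk⟩ := mem_filter.mp hσ
      obtain ⟨hσS, -, ht⟩ := mem_filter.mp hσ
      refine mem_sigma.mpr ⟨mem_filter.mpr ⟨?_, ?_⟩, mul_inv_cycleOf_mem_markedPerms hσ⟩
      · have : σ.toList v = List.iterate σ v (k + 1) := by rw [← hk]; rfl
        change σ.toList v ∈ _
        rw [this]
        exact iterate_mem_walkLists hσS k (ht v (by simp)).1
      · rw [card_union_toList hσS, hk]
    · intro σ _ τ _ h
      simp only [Sigma.mk.injEq, heq_eq_eq] at h
      have hc : σ.cycleOf v = τ.cycleOf v := by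
        rw [← formPerm_toList, h.1, formPerm_toList]
      have h2 := h.2
      rw [hc] at h2
      exact mul_right_cancel h2
  have hsum : ((W.sigma fun L => G.markedPerms (S ∪ L.toFinset) l t).card : ℝ) *
      d ^ (S.card + (k + 1) + t.length) ≤ d ^ k * B := by
    rw [card_sigma, Nat.cast_sum, sum_mul]
    calc _ ≤ ∑ L ∈ W, B := by
          refine sum_le_sum fun L hL => ?_
          have hL' := (mem_filter.mp hL).2
          have := hB _ hL'
          rwa [hL'] at this
      _ = W.card * B := by rw [sum_const, nsmul_eq_mul]
      _ ≤ d ^ k * B := by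
          refine mul_le_mul_of_nonneg_right ?_ hB0
          exact_mod_cast (card_filter_le _ _).trans (card_walkLists_le hG k v)
  refine le_of_mul_le_mul_left (a := (d : ℝ) ^ k) ?_ (by positivity)
  refine le_trans ?_ hsum
  have : (d : ℝ) ^ (S.card + (k + 1) + t.length) = d ^ k * d ^ (S.card + (v :: t).length) := by
    rw [← pow_add, List.length_cons]
    congr 1
    ring
  rw [this, mul_left_comm]
  refine mul_le_mul_of_nonneg_right ?_ (by positivity)
  exact_mod_cast hle

theorem card_markedPerms_le {l M : ℕ} {B : ℝ} (hd : 0 < d) (hG : G.IsRegularOfDegree d)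
    (hB : ∀ S : Finset V, S.card ≤ M → ((G.adjPerms S).card : ℝ) * d ^ S.card ≤ B)
    (t : List V) (S : Finset V) (hS : S.card + t.length * l ≤ M) :
    ((G.markedPerms S l t).card : ℝ) * d ^ (S.card + t.length) ≤ l ^ t.length * B := by
  have hB0 : 0 ≤ B := by
    refine le_trans ?_ (hB ∅ (by simp))
    positivity
  induction t generalizing S with
  | nil =>
    have h := hB S (by simpa using hS)
    simp only [List.length_nil, add_zero, pow_zero, one_mul]
    refine le_trans ?_ h
    refine mul_le_mul_of_nonneg_right ?_ (by positivity)
    exact_mod_cast card_filter_le _ _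
  | cons v t ih =>
    have hfib : (G.markedPerms S l (v :: t)).card = ∑ k ∈ range l,
        ((G.markedPerms S l (v :: t)).filter
          fun σ => (σ.cycleOf v).support.card = k + 1).card := by
      -- The subtraction is harmless: `v` is moved, so its cycle has length at least two.
      rw [card_eq_sum_card_fiberwise (f := fun σ => (σ.cycleOf v).support.card - 1) (t := range l)]
      · refine sum_congr rfl fun k _ => congrArg card (filter_congr fun σ hσ => ?_)
        obtain ⟨hσS, -, ht⟩ := mem_filter.mp hσ
        have h2 := (two_le_card_support_cycleOf_iff (f := σ) (x := v)).mpr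
          ((mem_adjPerms.mp hσS).2 v (ht v (by simp)).1).ne'
        omega
      · intro σ hσ
        obtain ⟨hσS, -, ht⟩ := mem_filter.mp hσ
        have h2 := (two_le_card_support_cycleOf_iff (f := σ) (x := v)).mpr
          ((mem_adjPerms.mp hσS).2 v (ht v (by simp)).1).ne'
        have h3 := (ht v (by simp)).2
        simp only [coe_range, Set.mem_Iio]
        omega
    rw [hfib, Nat.cast_sum, sum_mul]
    calc _ ≤ ∑ k ∈ range l, (l : ℝ) ^ t.length * B := by
          refine sum_le_sum fun k hk => card_markedPerms_filter_le hd hG (by positivity) fun T hT => ih T ?_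
          rw [hT]
          rw [List.length_cons, add_mul, one_mul] at hS
          have := mem_range.mp hk
          omega
      _ = _ := by rw [sum_const, card_range, nsmul_eq_mul, List.length_cons, pow_succ]; ring

variable (G) in
/-- The cycles of length at most `l` of a permutation. -/
def shortCycles (σ : Equiv.Perm V) (l : ℕ) : Finset (Equiv.Perm V) :=
  σ.cycleFactorsFinset.filter fun c => c.support.card ≤ l

/-- The left side counts ordered `j`-tuples of distinct short cycles; a representative on each cycle
gives a tuple of marked vertices. -/
theorem descFactorial_card_shortCycles_le {l : ℕ} (hσ : σ ∈ G.adjPerms ∅) (j : ℕ) :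
    (shortCycles σ l).card.descFactorial j ≤
      (univ.filter fun t : Fin j → V => σ ∈ G.markedPerms ∅ l (List.ofFn t)).card := by
  have hne : ∀ c : shortCycles σ l, ∃ v, v ∈ (c : Equiv.Perm V).support := fun c =>
    IsCycle.nonempty_support (mem_cycleFactorsFinset_iff.mp (mem_filter.mp c.2).1).1
  choose rep hrep using hne
  have hcyc : ∀ c, σ.cycleOf (rep c) = c := fun c =>
    (cycle_is_cycleOf (hrep c) (mem_filter.mp c.2).1).symm
  have hcard : (shortCycles σ l).card.descFactorial j =
      (univ : Finset (Fin j ↪ shortCycles σ l)).card := by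
    rw [card_univ, Fintype.card_embedding_eq, Fintype.card_fin, Fintype.card_coe]
  rw [hcard]
  refine card_le_card_of_injOn (fun f i => rep (f i)) ?_ ?_
  · intro f _
    refine mem_filter.mpr ⟨mem_univ _, mem_filter.mpr ⟨hσ, ?_, ?_⟩⟩
    · rw [List.map_ofFn, List.nodup_ofFn]
      intro a b hab
      simp only [Function.comp, hcyc] at hab
      exact f.injective (Subtype.ext hab)
    · intro v hv
      obtain ⟨i, rfl⟩ := List.mem_ofFn.mp hv
      rw [hcyc]
      exact ⟨notMem_empty _, (mem_filter.mp (f i).2).2⟩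
  · intro f _ g _ h
    ext i
    have h1 := congrArg σ.cycleOf (congrFun h i)
    simp only [hcyc] at h1
    rw [h1]

/-- Markov's inequality for the `j`-th factorial moment of the number of short cycles, with double
counting of pairs of a permutation and a marked `j`-tuple. -/
theorem card_filter_shortCycles_le {l M j K : ℕ} {B : ℝ} (hd : 0 < d)
    (hG : G.IsRegularOfDegree d)
    (hB : ∀ S : Finset V, S.card ≤ M → ((G.adjPerms S).card : ℝ) * d ^ S.card ≤ B)
    (hM : j * l ≤ M) :
    (((G.adjPerms ∅).filter fun σ => K ≤ (shortCycles σ l).card).card : ℝ) *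
      K.descFactorial j * d ^ j ≤ (Fintype.card V * l) ^ j * B := by
  have hd0 : (0 : ℝ) < d := by exact_mod_cast hd
  have h1 : ((G.adjPerms ∅).filter fun σ => K ≤ (shortCycles σ l).card).card *
      K.descFactorial j ≤ ∑ t : Fin j → V, (G.markedPerms ∅ l (List.ofFn t)).card := by
    rw [← smul_eq_mul]
    refine (card_nsmul_le_sum _ (fun σ => (univ.filter fun t : Fin j → V =>
      σ ∈ G.markedPerms ∅ l (List.ofFn t)).card) _ ?_).trans ?_
    · intro σ hσ
      obtain ⟨h, hK⟩ := mem_filter.mp hσ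
      exact (Nat.descFactorial_le _ hK).trans (descFactorial_card_shortCycles_le h j)
    · simp only [card_filter]
      rw [sum_comm]
      refine sum_le_sum fun t _ => ?_
      rw [← card_filter]
      exact card_le_card fun σ hσ => (mem_filter.mp hσ).2
  have h2 : ∀ t : Fin j → V, ((G.markedPerms ∅ l (List.ofFn t)).card : ℝ) * d ^ j ≤ l ^ j * B := by
    intro t
    have := card_markedPerms_le hd hG hB (List.ofFn t) ∅ (by simpa using hM)
    simpa using this
  calc _ ≤ (∑ t : Fin j → V, ((G.markedPerms ∅ l (List.ofFn t)).card : ℝ)) * d ^ j := by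
        refine mul_le_mul_of_nonneg_right ?_ (by positivity)
        exact_mod_cast h1
    _ ≤ ∑ t : Fin j → V, (l : ℝ) ^ j * B := by
        rw [sum_mul]
        exact sum_le_sum fun t _ => h2 t
    _ = _ := by
        rw [sum_const, card_univ, Fintype.card_fun, Fintype.card_fin, nsmul_eq_mul]
        push_cast
        ring

theorem card_cycleFactorsFinset_mul_le (σ : Equiv.Perm V) (l : ℕ) :
    σ.cycleFactorsFinset.card * l ≤ (shortCycles σ l).card * l + Fintype.card V := by
  have h1 := card_filter_add_card_filter_not (s := σ.cycleFactorsFinset)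
    (fun c => c.support.card ≤ l)
  have h2 : (σ.cycleFactorsFinset.filter fun c => ¬ c.support.card ≤ l).card * l ≤
      Fintype.card V := by
    calc _ ≤ ∑ c ∈ σ.cycleFactorsFinset.filter (fun c => ¬ c.support.card ≤ l), c.support.card := by
          rw [← smul_eq_mul]
          exact card_nsmul_le_sum _ _ _ fun c hc => (not_le.mp (mem_filter.mp hc).2).le
      _ ≤ ∑ c ∈ σ.cycleFactorsFinset, c.support.card :=
          sum_le_sum_of_subset (filter_subset _ _)
      _ = σ.support.card := by
          rw [← sum_cycleType, cycleType_def]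
          rfl
      _ ≤ _ := card_le_univ _
  rw [shortCycles, ← h1, add_mul]
  omega

end Peeling

end SimpleGraph

namespace SimpleGraph

open Finset

/-! ### Removing breaks from cyclic orderings. -/

section Orderings

set_option linter.unusedSectionVars false

variable {V : Type*} [Fintype V] [DecidableEq V] (G : SimpleGraph V) [DecidableRel G.Adj] {m : ℕ}

/-- The positions of a cyclic ordering at which consecutive vertices are not adjacent. -/
def breaks (w : Fin (m + 1) ≃ V) : Finset (Fin (m + 1)) :=
  univ.filter fun i => ¬ G.Adj (w i) (w (i + 1))

variable {G} {d : ℕ}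

theorem mem_breaks {w : Fin (m + 1) ≃ V} {i : Fin (m + 1)} :
    i ∈ G.breaks w ↔ ¬ G.Adj (w i) (w (i + 1)) := by
  simp [breaks]

/-- The permutation of the positions which reverses the initial segment up to `j`. -/
def reversePrefix (j : Fin (m + 1)) : Equiv.Perm (Fin (m + 1)) :=
  Function.Involutive.toPerm (fun i => if i ≤ j then ⟨j - i, by omega⟩ else i) (by
    intro i
    rcases le_or_gt i j with h | h
    · have h' : (i : ℕ) ≤ j := h
      have h2 : (⟨j - i, by omega⟩ : Fin (m + 1)) ≤ j := by
        rw [Fin.le_def]; simp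
      simp only [h, if_true, h2]
      ext
      simp only
      omega
    · simp [not_le.mpr h])

theorem reversePrefix_of_le {i j : Fin (m + 1)} (h : i ≤ j) :
    reversePrefix j i = ⟨j - i, by omega⟩ := by
  simp [reversePrefix, Function.Involutive.toPerm, h]

theorem reversePrefix_of_lt {i j : Fin (m + 1)} (h : j < i) : reversePrefix j i = i := by
  simp [reversePrefix, Function.Involutive.toPerm, not_le.mpr h]

theorem reversePrefix_zero : reversePrefix (0 : Fin (m + 1)) = 1 := by
  ext i
  rcases eq_or_ne i 0 with rfl | h
  · simp [reversePrefix_of_le]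
  · rw [reversePrefix_of_lt (Fin.pos_iff_ne_zero.mpr h)]
    simp

theorem card_breaks_rotate (w : Fin (m + 1) ≃ V) (r : Fin (m + 1)) :
    (G.breaks ((Equiv.addRight r).trans w)).card = (G.breaks w).card := by
  refine card_bij (fun i _ => i + r) ?_ (fun _ _ _ _ h => add_right_cancel h) ?_
  · intro i hi
    rw [mem_breaks] at hi ⊢
    simpa [add_right_comm] using hi
  · intro i hi
    rw [mem_breaks] at hi
    refine ⟨i - r, ?_, by simp⟩
    rw [mem_breaks]
    have : i - r + 1 + r = i + 1 := by abel
    simpa [this] using hi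

/-- Dirac's pigeonhole: the two sets of candidate positions have size `d` and both miss the last
position, as `G` has no loops and the last position plus one is `0`. They lie among `m < 2d`
positions, so they meet. -/
theorem exists_crossing (hG : G.IsRegularOfDegree d) (hd : m + 1 ≤ 2 * d) (w : Fin (m + 1) ≃ V) :
    ∃ j : Fin (m + 1), j ≠ Fin.last m ∧ G.Adj (w (Fin.last m)) (w j) ∧ G.Adj (w 0) (w (j + 1)) := by
  set A := univ.filter fun j : Fin (m + 1) => G.Adj (w (Fin.last m)) (w j) with hA
  set B := univ.filter fun j : Fin (m + 1) => G.Adj (w 0) (w (j + 1)) with hB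
  have hAc : A.card = d := by
    rw [← hG (w (Fin.last m)), ← card_neighborFinset_eq_degree]
    refine card_bij (fun j _ => w j) (fun j hj => by simpa [hA] using hj)
      (fun _ _ _ _ h => w.injective h) fun v hv => ⟨w.symm v, by simpa [hA] using hv, by simp⟩
  have hBc : B.card = d := by
    rw [← hG (w 0), ← card_neighborFinset_eq_degree]
    refine card_bij (fun j _ => w (j + 1)) (fun j hj => by simpa [hB] using hj)
      (fun _ _ _ _ h => add_right_cancel (w.injective h))
      fun v hv => ⟨w.symm v - 1, by simpa [hB] using hv, by simp⟩
  have hsub : A ∪ B ⊆ univ.erase (Fin.last m) := by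
    intro j hj
    rw [mem_erase]
    refine ⟨?_, mem_univ _⟩
    rintro rfl
    simp [hA, hB] at hj
  have h1 := card_le_card hsub
  rw [card_erase_of_mem (mem_univ _), card_univ, Fintype.card_fin] at h1
  have h2 := card_union_add_card_inter A B
  have h3 : 0 < (A ∩ B).card := by omega
  obtain ⟨j, hj⟩ := card_pos.mp h3
  have hj' := hsub (mem_union_left _ (mem_of_mem_inter_left hj))
  refine ⟨j, (mem_erase.mp hj').1, ?_, ?_⟩
  · exact (mem_filter.mp (mem_of_mem_inter_left hj)).2
  · exact (mem_filter.mp (mem_of_mem_inter_right hj)).2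

/-- The new order is `w j, ..., w 0, w (j+1), ..., w m`. Its two new junctions, `w 0` to `w (j+1)`
and `w m` to `w j`, are edges; the other pairs are old, and the break at the last position is gone.
-/
theorem card_breaks_reversePrefix_lt {w : Fin (m + 1) ≃ V} (hw : Fin.last m ∈ G.breaks w)
    {j : Fin (m + 1)} (hj : j ≠ Fin.last m) (h1 : G.Adj (w (Fin.last m)) (w j))
    (h2 : G.Adj (w 0) (w (j + 1))) :
    (G.breaks ((reversePrefix j).trans w)).card < (G.breaks w).card := by
  have hjm : (j : ℕ) < m := lt_of_le_of_ne (Nat.lt_succ_iff.mp j.2) fun h => hj (Fin.ext h)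
  have hsucc : ∀ i : Fin (m + 1), (i : ℕ) < m → ((i + 1 : Fin (m + 1)) : ℕ) = i + 1 := by
    intro i hi
    exact Fin.val_add_one_of_lt (by rw [Fin.lt_def]; exact hi)
  -- classification of the new breaks
  have hcases : ∀ i ∈ G.breaks ((reversePrefix j).trans w),
      ((i : ℕ) < j ∧ (⟨j - 1 - i, by omega⟩ : Fin (m + 1)) ∈ G.breaks w) ∨
      (((j : ℕ) < i ∧ (i : ℕ) < m) ∧ i ∈ G.breaks w) := by
    intro i hi
    rw [mem_breaks] at hi
    simp only [Equiv.trans_apply] at hi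
    rcases lt_trichotomy (i : ℕ) j with h | h | h
    · left
      refine ⟨h, ?_⟩
      rw [reversePrefix_of_le h.le, reversePrefix_of_le
        (by rw [Fin.le_def, hsucc i (by omega)]; omega), G.adj_comm] at hi
      rw [mem_breaks]
      convert hi using 3
      · ext; simp only; rw [hsucc i (by omega)]; omega
      · ext; rw [hsucc _ (by simp only; omega)]; simp only; omega
    · exfalso
      have hij : i = j := Fin.ext h
      rw [hij, reversePrefix_of_le le_rfl, reversePrefix_of_lt
        (by rw [Fin.lt_def, hsucc j hjm]; omega)] at hi
      apply hi
      convert h2 using 2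
      ext; simp
    · right
      have him : (i : ℕ) < m := by
        by_contra hcon
        have : i = Fin.last m := Fin.ext (by have := i.2; simp only [Fin.val_last]; omega)
        rw [this, reversePrefix_of_lt (by rw [Fin.lt_def]; simpa using hjm)] at hi
        apply hi
        rw [Fin.last_add_one, reversePrefix_of_le (Fin.zero_le _)]
        simpa using h1
      refine ⟨⟨h, him⟩, ?_⟩
      rw [reversePrefix_of_lt h, reversePrefix_of_lt (by rw [Fin.lt_def, hsucc i him]; omega)] at hi
      exact mem_breaks.mpr hi
  refine lt_of_le_of_lt ?_ (card_erase_lt_of_mem hw)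
  -- Inside the reversed prefix, the pair at position `i` is the old pair at position `j - 1 - i`.
  refine card_le_card_of_injOn
    (fun i => if (i : ℕ) < j then ⟨j - 1 - i, by omega⟩ else i) ?_ ?_
  · intro i hi
    rw [coe_erase, Set.mem_sdiff, Set.mem_singleton_iff]
    rcases hcases i hi with ⟨h, hb⟩ | ⟨⟨h, him⟩, hb⟩
    · simp only [h, if_true]
      refine ⟨hb, fun hlast => ?_⟩
      have := congrArg Fin.val hlast
      simp only [Fin.val_last] at this
      omega
    · simp only [not_lt.mpr h.le, if_false]
      refine ⟨hb, fun hlast => ?_⟩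
      have := congrArg Fin.val hlast
      simp only [Fin.val_last] at this
      omega
  · intro i hi i' hi' heq
    have heq' := congrArg Fin.val heq
    have c1 := hcases i hi
    have c2 := hcases i' hi'
    ext
    simp only at heq'
    split_ifs at heq' <;> (try simp only at heq') <;> omega

variable (G) in
/-- The cyclic orderings with at most `b` breaks. -/
def orderings (m b : ℕ) : Finset (Fin (m + 1) ≃ V) :=
  univ.filter fun w => (G.breaks w).card ≤ b

theorem exists_rotate_reverse (hG : G.IsRegularOfDegree d) (hd : m + 1 ≤ 2 * d) {b : ℕ}
    {w : Fin (m + 1) ≃ V} (hw : w ∈ G.orderings m (b + 1)) :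
    ∃ p : Fin (m + 1) × Fin (m + 1),
      (reversePrefix p.2).trans ((Equiv.addRight p.1).trans w) ∈ G.orderings m b := by
  have hwb := (mem_filter.mp hw).2
  rcases (G.breaks w).eq_empty_or_nonempty with h0 | ⟨i, hi⟩
  · refine ⟨(0, 0), mem_filter.mpr ⟨mem_univ _, ?_⟩⟩
    rw [reversePrefix_zero]
    change (G.breaks ((Equiv.addRight 0).trans w)).card ≤ b
    rw [card_breaks_rotate, h0]
    simp
  · set w' := (Equiv.addRight (i - Fin.last m)).trans w with hw'
    have hlast : Fin.last m ∈ G.breaks w' := by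
      rw [mem_breaks] at hi ⊢
      have e1 : Fin.last m + (i - Fin.last m) = i := by abel
      have e2 : Fin.last m + 1 + (i - Fin.last m) = i + 1 := by abel
      simp only [hw', Equiv.trans_apply, Equiv.coe_addRight, e1, e2]
      exact hi
    obtain ⟨j, hj, h1, h2⟩ := exists_crossing hG hd w'
    refine ⟨(i - Fin.last m, j), mem_filter.mpr ⟨mem_univ _, ?_⟩⟩
    have h3 := card_breaks_reversePrefix_lt hlast hj h1 h2
    rw [hw', card_breaks_rotate] at h3
    change (G.breaks ((reversePrefix j).trans w')).card ≤ b
    rw [hw']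
    omega

/-- Rotation and reversal are invertible once their two parameters are known, and there are `(m + 1)
^ 2` parameter pairs. -/
theorem card_orderings_succ_le (hG : G.IsRegularOfDegree d) (hd : m + 1 ≤ 2 * d) (b : ℕ) :
    (G.orderings m (b + 1)).card ≤ (m + 1) ^ 2 * (G.orderings m b).card := by
  have hex : ∀ w : G.orderings m (b + 1), ∃ p : Fin (m + 1) × Fin (m + 1),
      (reversePrefix p.2).trans ((Equiv.addRight p.1).trans w) ∈ G.orderings m b :=
    fun w => exists_rotate_reverse hG hd w.2
  choose p hp using hex
  have h : Fintype.card (G.orderings m (b + 1)) ≤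
      Fintype.card ((Fin (m + 1) × Fin (m + 1)) × G.orderings m b) := by
    refine Fintype.card_le_of_injective (fun w => (p w, ⟨_, hp w⟩)) fun w w' hww => ?_
    simp only [Prod.mk.injEq, Subtype.mk.injEq] at hww
    obtain ⟨h1, h2⟩ := hww
    rw [h1] at h2
    ext i
    have h3 := DFunLike.congr_fun h2
      ((reversePrefix (p w').2).symm ((Equiv.addRight (p w').1).symm i))
    simpa using h3
  simpa [sq] using h

theorem card_orderings_le (hG : G.IsRegularOfDegree d) (hd : m + 1 ≤ 2 * d) (b : ℕ) :
    (G.orderings m b).card ≤ (m + 1) ^ (2 * b) * (G.orderings m 0).card := by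
  induction b with
  | zero => simp
  | succ b ih =>
    refine (card_orderings_succ_le hG hd b).trans ((Nat.mul_le_mul_left _ ih).trans_eq ?_)
    ring

end Orderings

end SimpleGraph

namespace SimpleGraph

open Finset

/-! ### From permutations with few cycles to orderings with few breaks. -/

section CyclesToOrderings

set_option linter.unusedSectionVars false

variable {V : Type*} [Fintype V] [DecidableEq V] {m : ℕ}

/-- A fixed point free permutation follows a cyclic ordering, with few exceptions if it has few
cycles. -/
theorem exists_ordering_of_perm (hV : Fintype.card V = m + 1) (σ : Equiv.Perm V)
    (hσ : ∀ v, σ v ≠ v) : ∃ w : Fin (m + 1) ≃ V,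
      (univ.filter fun i => σ (w i) ≠ w (i + 1)).card ≤ σ.cycleFactorsFinset.card + 1 := by
  have hsupp : ∀ v, v ∈ σ.support := fun v => Equiv.Perm.mem_support.mpr (hσ v)
  have : Nonempty V := Fintype.card_pos_iff.mp (by omega)
  have hne : ∀ c : Equiv.Perm V, ∃ v, c ∈ σ.cycleFactorsFinset → v ∈ c.support := by
    intro c
    by_cases hc : c ∈ σ.cycleFactorsFinset
    · obtain ⟨v, hv⟩ := (Equiv.Perm.mem_cycleFactorsFinset_iff.mp hc).1.nonempty_support
      exact ⟨v, fun _ => hv⟩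
    · exact ⟨Classical.arbitrary V, fun h => absurd h hc⟩
  choose rep hrep using hne
  have hcyc : ∀ c ∈ σ.cycleFactorsFinset, σ.cycleOf (rep c) = c := fun c hc =>
    (Equiv.Perm.cycle_is_cycleOf (hrep c hc) hc).symm
  -- The ordering is the concatenation of the cycles, each opened at its representative.
  set LL := σ.cycleFactorsFinset.toList.map fun c => σ.toList (rep c) with hLL
  have hmemLL : ∀ l ∈ LL, ∃ c ∈ σ.cycleFactorsFinset, l = σ.toList (rep c) := by
    intro l hl
    obtain ⟨c, hc, rfl⟩ := List.mem_map.mp hl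
    exact ⟨c, mem_toList.mp hc, rfl⟩
  have hnodup : LL.flatten.Nodup := by
    rw [List.nodup_flatten]
    refine ⟨fun l hl => ?_, ?_⟩
    · obtain ⟨c, -, rfl⟩ := hmemLL l hl
      exact σ.nodup_toList _
    · rw [hLL, List.pairwise_map]
      refine (σ.cycleFactorsFinset.nodup_toList).imp_of_mem fun {c c'} hc hc' hcc' => ?_
      intro y hy hy'
      have h1 := (Equiv.Perm.mem_toList_iff.mp hy).1.cycleOf_eq
      have h2 := (Equiv.Perm.mem_toList_iff.mp hy').1.cycleOf_eq
      rw [hcyc c (mem_toList.mp hc)] at h1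
      rw [hcyc c' (mem_toList.mp hc')] at h2
      exact hcc' (h1.trans h2.symm)
  have hmem : ∀ v, v ∈ LL.flatten := by
    intro v
    have hc := Equiv.Perm.cycleOf_mem_cycleFactorsFinset_iff.mpr (hsupp v)
    refine List.mem_flatten.mpr ⟨_, List.mem_map.mpr ⟨_, mem_toList.mpr hc, rfl⟩, ?_⟩
    rw [Equiv.Perm.mem_toList_iff]
    refine ⟨?_, hsupp _⟩
    have := hrep _ hc
    rw [Equiv.Perm.mem_support_cycleOf_iff] at this
    exact this.1.symm
  -- The final entries of the opened cycles: only at these can the successor in the concatenation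
  -- differ from the image under `σ`.
  set last := σ.cycleFactorsFinset.image fun c => σ⁻¹ (rep c) with hlast
  have hchain : LL.flatten.IsChain fun a b => b = σ a ∨ a ∈ last := by
    rw [List.isChain_flatten]
    · refine ⟨fun l hl => ?_, ?_⟩
      · obtain ⟨c, -, rfl⟩ := hmemLL l hl
        rw [List.isChain_iff_getElem]
        intro i hi
        left
        rw [Equiv.Perm.getElem_toList, Equiv.Perm.getElem_toList, pow_succ', Equiv.Perm.mul_apply]
      · refine (List.pairwise_of_forall_mem_list fun l hl l' _ x hx y _ => Or.inr ?_).isChain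
        obtain ⟨c, hc, rfl⟩ := hmemLL l hl
        refine mem_image.mpr ⟨c, hc, ?_⟩
        rw [Equiv.Perm.inv_eq_iff_eq]
        rw [Option.mem_def, List.getLast?_eq_getElem?] at hx
        obtain ⟨hlt, hx⟩ := List.getElem?_eq_some_iff.mp hx
        rw [Equiv.Perm.getElem_toList] at hx
        rw [← hx, ← Equiv.Perm.mul_apply, ← pow_succ']
        have hpos := Equiv.Perm.length_toList_pos_of_mem_support σ _ (hsupp (rep c))
        rw [Nat.sub_add_cancel hpos, Equiv.Perm.length_toList]
        have := Equiv.Perm.pow_mod_card_support_cycleOf_self_apply σ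
          (σ.cycleOf (rep c)).support.card (rep c)
        rw [Nat.mod_self, pow_zero] at this
        exact this
    · intro h
      obtain ⟨c, -, hc⟩ := hmemLL _ h
      exact Equiv.Perm.toList_eq_nil_iff.mp hc.symm (hsupp _)
  let e := List.Nodup.getEquivOfForallMemList LL.flatten hnodup hmem
  have hlen : LL.flatten.length = m + 1 := by
    have := Fintype.card_congr e
    rwa [Fintype.card_fin, hV] at this
  let w : Fin (m + 1) ≃ V := (finCongr hlen.symm).trans e
  have hw : ∀ i : Fin (m + 1), w i = LL.flatten[(i : ℕ)]'(by rw [hlen]; exact i.2) := fun i => rfl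
  refine ⟨w, ?_⟩
  -- The extra element is the last position, where the cyclic ordering wraps around; it accounts for
  -- the `+ 1`.
  have hsub : ((univ.filter fun i => σ (w i) ≠ w (i + 1)).image w) ⊆
      insert (w (Fin.last m)) last := by
    intro v hv
    obtain ⟨i, hi, rfl⟩ := mem_image.mp hv
    rw [mem_insert]
    rcases eq_or_ne i (Fin.last m) with rfl | hne
    · exact Or.inl rfl
    · right
      have him : (i : ℕ) < m := lt_of_le_of_ne (Nat.lt_succ_iff.mp i.2) fun h => hne (Fin.ext h)
      have hsucc : ((i + 1 : Fin (m + 1)) : ℕ) = i + 1 :=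
        Fin.val_add_one_of_lt (by rw [Fin.lt_def]; exact him)
      have h := List.isChain_iff_getElem.mp hchain i (by omega)
      refine h.resolve_left fun h' => (mem_filter.mp hi).2 ?_
      rw [hw i, ← h', hw (i + 1)]
      simp only [hsucc]
  rw [← card_image_of_injective _ w.injective]
  refine (card_le_card hsub).trans ((card_insert_le _ _).trans ?_)
  exact Nat.succ_le_succ card_image_le

variable {G : SimpleGraph V} [DecidableRel G.Adj]

/-- The permutation is encoded by an ordering that it follows except at no more than `b + 1`
vertices, by a list `u` covering these vertices, and by their images. Every break is such an
exception, since `σ` moves vertices to neighbours. -/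
theorem card_filter_cycles_le (hV : Fintype.card V = m + 1) (b : ℕ) :
    ((G.adjPerms ∅).filter fun σ => σ.cycleFactorsFinset.card ≤ b).card ≤
      (G.orderings m (b + 1)).card * (m + 1) ^ (2 * (b + 1)) := by
  set F := (G.adjPerms ∅).filter fun σ => σ.cycleFactorsFinset.card ≤ b with hF
  have : Nonempty V := Fintype.card_pos_iff.mp (by omega)
  have hex : ∀ σ : F, ∃ (w : G.orderings m (b + 1)) (u : Fin (b + 1) → V),
      ∀ v, (σ : Equiv.Perm V) v ≠ w.1 (w.1.symm v + 1) → v ∈ Set.range u := by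
    rintro ⟨σ, hσ⟩
    obtain ⟨hσ, hb⟩ := mem_filter.mp hσ
    have hadj : ∀ v, G.Adj v (σ v) := fun v => (mem_adjPerms.mp hσ).2 v (notMem_empty v)
    obtain ⟨w, hw⟩ := exists_ordering_of_perm hV σ fun v => (hadj v).ne'
    set D := univ.filter fun i => σ (w i) ≠ w (i + 1)
    have hD : D.card ≤ b + 1 := by omega
    have hword : w ∈ G.orderings m (b + 1) := by
      refine mem_filter.mpr ⟨mem_univ _, le_trans (card_le_card fun i hi => ?_) hD⟩
      rw [mem_breaks] at hi
      refine mem_filter.mpr ⟨mem_univ _, fun h => hi ?_⟩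
      rw [← h]
      exact hadj _
    have hcov : ∃ u : Fin (b + 1) → V, (D.image w : Set V) ⊆ Set.range u := by
      have hc : (D.image w).card ≤ Fintype.card (Fin (b + 1)) := by
        rw [card_image_of_injective _ w.injective, Fintype.card_fin]
        exact hD
      rcases (D.image w).eq_empty_or_nonempty with h0 | hne
      · exact ⟨fun _ => Classical.arbitrary V, by simp [h0]⟩
      · have : Nonempty (D.image w) := hne.to_subtype
        obtain ⟨f⟩ : Nonempty ((D.image w) ↪ Fin (b + 1)) :=
          Function.Embedding.nonempty_of_card_le (by rw [Fintype.card_coe]; exact hc)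
        refine ⟨fun i => (Function.invFun f i : D.image w), fun v hv => ⟨f ⟨v, hv⟩, ?_⟩⟩
        simp only [Function.leftInverse_invFun f.injective _]
    obtain ⟨u, hu⟩ := hcov
    refine ⟨⟨w, hword⟩, u, fun v hv => hu ?_⟩
    rw [mem_coe, mem_image]
    exact ⟨w.symm v, mem_filter.mpr ⟨mem_univ _, by simpa using hv⟩, by simp⟩
  choose w u hu using hex
  have h : Fintype.card F ≤ Fintype.card (G.orderings m (b + 1) ×
      ((Fin (b + 1) → V) × (Fin (b + 1) → V))) := by
    refine Fintype.card_le_of_injective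
      (fun σ => (w σ, (u σ, fun i => (σ : Equiv.Perm V) (u σ i)))) fun σ τ h => ?_
    simp only [Prod.mk.injEq] at h
    obtain ⟨h1, h2, h3⟩ := h
    refine Subtype.ext (Equiv.ext fun v => ?_)
    by_cases hv : v ∈ Set.range (u σ)
    · obtain ⟨i, rfl⟩ := hv
      have := congrFun h3 i
      rw [← h2] at this
      exact this
    · have e1 := not_not.mp (mt (hu σ v) hv)
      rw [h2] at hv
      have e2 := not_not.mp (mt (hu τ v) hv)
      rw [e1, e2, h1]
  rw [Fintype.card_prod, Fintype.card_prod, Fintype.card_fun, Fintype.card_fin, hV,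
    Fintype.card_coe, Fintype.card_coe] at h
  refine h.trans_eq ?_
  ring

end CyclesToOrderings

end SimpleGraph

namespace SimpleGraph

open Finset

/-! ### Hamilton cycles, break-free orderings and permutations. -/

section HamiltonCycles

set_option linter.unusedSectionVars false

variable {V : Type*} [Fintype V] [DecidableEq V] {G : SimpleGraph V} [DecidableRel G.Adj] {m : ℕ}

theorem exists_hamiltonCycle_of_ordering {k : ℕ} {w : Fin (k + 2 + 1) ≃ V}
    (hw : w ∈ G.orderings (k + 2) 0) :
    ∃ H ∈ G.hamiltonCycles, ∀ u v, H.Adj u v ↔ ∃ i, s(w i, w (i + 1)) = s(u, v) := by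
  have hadj : ∀ i, G.Adj (w i) (w (i + 1)) := by
    intro i
    have h := card_eq_zero.mp (Nat.le_zero.mp (mem_filter.mp hw).2)
    by_contra hcon
    exact notMem_empty i (h ▸ mem_breaks.mpr hcon)
  let f : cycleGraph (k + 3) →g G :=
    { toFun := w
      map_rel' := by
        intro a b hab
        rcases cycleGraph_adj.mp hab with h | h
        · have : a = b + 1 := by rw [← h]; abel
          rw [this]
          exact (hadj b).symm
        · have : b = a + 1 := by rw [← h]; abel
          rw [this]
          exact hadj a }
  have hc : (cycleGraph.cycle k).IsHamiltonianCycle :=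
    Walk.isHamiltonianCycle_iff_isCycle_and_length_eq.mpr ⟨cycleGraph.isCycle_cycle, by simp⟩
  refine ⟨((cycleGraph.cycle k).map f).toSubgraph, ⟨_, _, hc.map w.bijective, rfl⟩, fun u v => ?_⟩
  -- The standard cycle of the cycle graph runs through the vertices in descending order, hence the
  -- negation.
  have hget : ∀ i : ℕ, i ≤ k + 3 →
      ((cycleGraph.cycle k).map f).getVert i = w (-(Fin.ofNat (k + 3) i)) := by
    intro i hi
    rw [Walk.getVert_map, cycleGraph.getVert_cycle hi]
    change w _ = w _
    congr 1
    ext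
    rw [Fin.val_neg']
    simp only [Fin.val_ofNat]
    rcases hi.eq_or_lt with rfl | h
    · simp
    · rw [Nat.mod_eq_of_lt h]
  rw [Walk.toSubgraph_adj_iff]
  constructor
  · rintro ⟨i, hi, hlt⟩
    rw [Walk.length_map, cycleGraph.length_cycle] at hlt
    rw [hget i hlt.le, hget (i + 1) hlt] at hi
    refine ⟨-(Fin.ofNat (k + 3) (i + 1)), ?_⟩
    have : -(Fin.ofNat (k + 3) (i + 1)) + 1 = -(Fin.ofNat (k + 3) i) := by
      have : Fin.ofNat (k + 3) (i + 1) = Fin.ofNat (k + 3) i + 1 := by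
        ext; simp [Fin.val_add]
      rw [this]; abel
    rw [this, Sym2.eq_swap]
    exact hi
  · rintro ⟨i, hi⟩
    refine ⟨((-(i + 1) : Fin (k + 3)) : ℕ), ?_, ?_⟩
    · have hlt := (-(i + 1) : Fin (k + 3)).2
      rw [hget _ hlt.le, hget _ hlt]
      have e1 : Fin.ofNat (k + 3) ((-(i + 1) : Fin (k + 3)) : ℕ) = -(i + 1) := by
        ext; simp
      have e2 : Fin.ofNat (k + 3) (((-(i + 1) : Fin (k + 3)) : ℕ) + 1) = -i := by
        have : Fin.ofNat (k + 3) (((-(i + 1) : Fin (k + 3)) : ℕ) + 1) =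
          Fin.ofNat (k + 3) ((-(i + 1) : Fin (k + 3)) : ℕ) + 1 := by
          ext; simp [Fin.val_add]
        rw [this, e1]; abel
      rw [e1, e2, neg_neg, neg_neg, Sym2.eq_swap]
      exact hi
    · rw [Walk.length_map, cycleGraph.length_cycle]
      exact (-(i + 1) : Fin (k + 3)).2

/-- Each vertex has two neighbours on the cycle, so two consecutive vertices determine the next one.
-/
theorem ordering_eq_of_edges_eq {k : ℕ} {w w' : Fin (k + 2 + 1) ≃ V}
    (hE : ∀ u v, (∃ i, s(w i, w (i + 1)) = s(u, v)) ↔ ∃ i, s(w' i, w' (i + 1)) = s(u, v))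
    (h0 : w 0 = w' 0) (h1 : w 1 = w' 1) : w = w' := by
  have key : ∀ i : ℕ, w (Fin.ofNat _ i) = w' (Fin.ofNat _ i) ∧
      w (Fin.ofNat _ (i + 1)) = w' (Fin.ofNat _ (i + 1)) := by
    intro i
    induction i with
    | zero => exact ⟨h0, h1⟩
    | succ i ih =>
      refine ⟨ih.2, ?_⟩
      set x := Fin.ofNat (k + 2 + 1) i with hx
      have e1 : Fin.ofNat (k + 2 + 1) (i + 1) = x + 1 := by ext; simp [Fin.val_add, hx]
      have e2 : Fin.ofNat (k + 2 + 1) (i + 1 + 1) = x + 1 + 1 := by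
        rw [← e1]; ext; simp [Fin.val_add]
      rw [e1] at ih
      rw [e2]
      obtain ⟨j, hj⟩ := (hE (w (x + 1)) (w (x + 1 + 1))).mp ⟨x + 1, rfl⟩
      rcases Sym2.eq_iff.mp hj with ⟨ha, hb⟩ | ⟨ha, hb⟩
      · rw [ih.2] at ha
        rw [← hb, w'.injective ha]
      · exfalso
        rw [ih.2] at hb
        have hjx : j = x := add_right_cancel (w'.injective hb)
        rw [hjx, ← ih.1] at ha
        have h2 := w.injective ha
        -- Walking back to the previous vertex would force `2 = 0` modulo the length, which is at
        -- least three.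
        have h3 : (1 + 1 : Fin (k + 2 + 1)) = 0 := by
          have : x + (1 + 1) = x + 0 := by rw [← add_assoc, ← h2, add_zero]
          exact add_left_cancel this
        have h4 : ((1 + 1 : Fin (k + 2 + 1)) : ℕ) = 2 := by
          change (1 % (k + 2 + 1) + 1 % (k + 2 + 1)) % (k + 2 + 1) = 2
          rw [Nat.mod_eq_of_lt (show 1 < k + 2 + 1 by omega),
            Nat.mod_eq_of_lt (show 1 + 1 < k + 2 + 1 by omega)]
        rw [h3] at h4
        exact absurd h4 (by simp)
  ext i
  have := (key i).1
  have hi : Fin.ofNat (k + 2 + 1) (i : ℕ) = i := by ext; simp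
  rwa [hi] at this

theorem card_orderings_zero_le (k : ℕ) (hV : Fintype.card V = k + 3) :
    (G.orderings (k + 2) 0).card ≤ G.numHamiltonCycles * (k + 3) ^ 2 := by
  choose! H hH hadj using fun (w : Fin (k + 2 + 1) ≃ V) (hw : w ∈ G.orderings (k + 2) 0) =>
    exists_hamiltonCycle_of_ordering hw
  have h : Nat.card (G.orderings (k + 2) 0) ≤ Nat.card (G.hamiltonCycles × (V × V)) := by
    refine Nat.card_le_card_of_injective
      (fun w => (⟨H w, hH w w.2⟩, (w.1 0, w.1 1))) fun w w' hww => ?_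
    simp only [Prod.mk.injEq, Subtype.mk.injEq] at hww
    obtain ⟨h1, h2, h3⟩ := hww
    refine Subtype.ext (ordering_eq_of_edges_eq (fun u v => ?_) h2 h3)
    rw [← hadj w w.2, ← hadj w' w'.2, h1]
  rw [Nat.card_prod, Nat.card_prod, Nat.card_eq_fintype_card (α := V), hV,
    Nat.card_coe_set_eq, Nat.card_eq_fintype_card, Fintype.card_coe] at h
  rw [numHamiltonCycles, sq]
  exact h

theorem exists_perm_of_hamiltonCycle (hV : Fintype.card V = m + 1) {H : G.Subgraph}
    (hH : H ∈ G.hamiltonCycles) :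
    ∃ σ ∈ G.adjPerms ∅, H.verts = Set.univ ∧ ∀ u v, H.Adj u v ↔ σ u = v ∨ σ v = u := by
  obtain ⟨a, p, hp, rfl⟩ := hH
  have hlen : p.length = m + 1 := hp.length_eq.trans hV
  have hclosed : p.getVert (m + 1) = p.getVert 0 := by
    rw [← hlen, Walk.getVert_length, Walk.getVert_zero]
  have hsurj : Function.Surjective fun i : Fin (m + 1) => p.getVert i := by
    intro v
    obtain ⟨i, hi, hle⟩ := Walk.mem_support_iff_exists_getVert.mp (hp.mem_support v)
    rw [hlen] at hle
    rcases hle.eq_or_lt with rfl | h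
    · exact ⟨0, by rw [← hi, hclosed]; simp⟩
    · exact ⟨⟨i, h⟩, hi⟩
  let w : Fin (m + 1) ≃ V := Equiv.ofBijective _
    ((Fintype.bijective_iff_surjective_and_card _).mpr ⟨hsurj, by rw [Fintype.card_fin, hV]⟩)
  have hw : ∀ i : Fin (m + 1), w i = p.getVert i := fun i => rfl
  have hw1 : ∀ i : Fin (m + 1), w (i + 1) = p.getVert (i + 1) := by
    intro i
    rcases eq_or_ne i (Fin.last m) with rfl | hne
    · rw [Fin.last_add_one, hw, Fin.val_last, hclosed]; simp
    · rw [hw, Fin.val_add_one_of_lt (Fin.lt_last_iff_ne_last.mpr hne)]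
  set σ : Equiv.Perm V := w.symm.trans ((Equiv.addRight 1).trans w) with hσ
  have hσw : ∀ i, σ (w i) = w (i + 1) := by intro i; simp [hσ]
  have hadj : ∀ u v, p.toSubgraph.Adj u v ↔ σ u = v ∨ σ v = u := by
    intro u v
    rw [Walk.toSubgraph_adj_iff]
    constructor
    · rintro ⟨i, hi, hlt⟩
      rw [hlen] at hlt
      have e1 := hw ⟨i, hlt⟩
      have e2 := hw1 ⟨i, hlt⟩
      simp only at e1 e2
      rw [← e1, ← e2] at hi
      rcases Sym2.eq_iff.mp hi with ⟨rfl, rfl⟩ | ⟨rfl, rfl⟩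
      · exact Or.inl (hσw _)
      · exact Or.inr (hσw _)
    · rintro (h | h)
      · refine ⟨w.symm u, ?_, by rw [hlen]; exact (w.symm u).2⟩
        rw [← hw, ← hw1, ← hσw, Equiv.apply_symm_apply, h]
      · refine ⟨w.symm v, ?_, by rw [hlen]; exact (w.symm v).2⟩
        rw [← hw, ← hw1, ← hσw, Equiv.apply_symm_apply, h, Sym2.eq_swap]
  refine ⟨σ, mem_adjPerms.mpr ⟨by simp, fun v _ => ?_⟩, ?_, hadj⟩
  · exact ((hadj v (σ v)).mpr (Or.inl rfl)).adj_sub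
  · rw [Walk.verts_toSubgraph, Set.eq_univ_iff_forall]
    exact hp.mem_support

/-- A cycle is recovered from either of its orientations, so choosing one for each cycle is
injective. -/
theorem numHamiltonCycles_le (hV : Fintype.card V = m + 1) :
    G.numHamiltonCycles ≤ (G.adjPerms ∅).card := by
  choose! σ hσ hverts hadj using fun (H : G.Subgraph) (hH : H ∈ G.hamiltonCycles) =>
    exists_perm_of_hamiltonCycle hV hH
  rw [numHamiltonCycles, ← Set.ncard_coe_finset]
  refine Set.ncard_le_ncard_of_injOn σ (fun H hH => hσ H hH) (fun H hH H' hH' h => ?_)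
    (Set.toFinite _)
  refine Subgraph.ext ((hverts H hH).trans (hverts H' hH').symm) ?_
  funext u v
  rw [eq_iff_iff, hadj H hH, hadj H' hH', h]

end HamiltonCycles

end SimpleGraph

namespace SimpleGraph

open Finset Filter

/-! ### Choice of parameters and error terms. -/

section Asymptotics

variable {V : Type*} [Fintype V] [DecidableEq V] {G : SimpleGraph V} [DecidableRel G.Adj] {d : ℕ}

theorem pow_le_card_adjPerms (hG : G.IsRegularOfDegree d) (hd : 0 < d) :
    ((d : ℝ) / Real.exp 1) ^ Fintype.card V ≤ (G.adjPerms ∅).card := by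
  have hcard : ∀ v, (univ.filter fun w => G.Adj v w).card = d := by
    intro v
    rw [← hG v, ← card_neighborFinset_eq_degree]
    congr 1
    ext w
    simp
  have h := card_perm_ge G.Adj hd hcard fun v => by simpa only [G.adj_comm] using hcard v
  refine h.trans_eq ?_
  congr 2
  ext σ
  simp [mem_adjPerms]

theorem numHamiltonCycles_le_mul (hG : G.IsRegularOfDegree d) (hd : 0 < d)
    (hn : Fintype.card V ≤ 2 * d) (hV : 0 < Fintype.card V) :
    (G.numHamiltonCycles : ℝ) ≤ (d / Real.exp 1) ^ Fintype.card V *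
      (Real.exp 5 * Fintype.card V ^ 4) := by
  obtain ⟨m, hm⟩ := Nat.exists_eq_succ_of_ne_zero hV.ne'
  have h1 := numHamiltonCycles_le (G := G) hm
  have h2 := card_adjPerms_mul_le (S := (∅ : Finset V)) hG hd hn hV (by simp) (by simp)
  rw [card_empty, pow_zero, mul_one] at h2
  exact le_trans (by exact_mod_cast h1) h2

/-- For `s` about `n^(1/4)`, the left side has order `s^9 * n^4 = s^25` and the right side order
`s^27`. The exponent `9` is the first to win, and the spare `s^2 ≥ 2^44` absorbs the constants. -/
theorem descFactorial_cube_ge {s n : ℕ} (hs : 2 ^ 22 ≤ s) (hn : n ≤ (s + 1) ^ 4) :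
    2 * ((2 * s) ^ 9 * (Real.exp 5 * n ^ 4)) ≤ ((s ^ 3).descFactorial 9 : ℝ) := by
  have hs' : (2 : ℝ) ^ 22 ≤ s := by exact_mod_cast hs
  have hs0 : (0 : ℝ) < s := lt_of_lt_of_le (by norm_num) hs'
  have h1 : (((s ^ 3 + 1 - 9) ^ 9 : ℕ) : ℝ) ≤ ((s ^ 3).descFactorial 9 : ℝ) := by
    exact_mod_cast Nat.pow_sub_le_descFactorial (s ^ 3) 9
  have h2 : (s : ℝ) ^ 3 / 2 ≤ ((s ^ 3 + 1 - 9 : ℕ) : ℝ) := by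
    have h16 : 16 ≤ s ^ 3 := by
      calc 16 ≤ (2 ^ 22) ^ 3 := by norm_num
        _ ≤ s ^ 3 := Nat.pow_le_pow_left hs 3
    have h16' : (16 : ℝ) ≤ (s : ℝ) ^ 3 := by exact_mod_cast h16
    rw [Nat.cast_sub (by omega)]
    push_cast
    linarith
  have h3 : ((s : ℝ) ^ 3 / 2) ^ 9 ≤ ((s ^ 3).descFactorial 9 : ℝ) := by
    refine le_trans ?_ h1
    push_cast
    exact pow_le_pow_left₀ (by positivity) h2 9
  refine le_trans ?_ h3
  have he : Real.exp 5 ≤ 2 ^ 8 := by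
    have h := Real.exp_one_lt_three
    have : Real.exp 5 = Real.exp 1 ^ 5 := by rw [← Real.exp_nat_mul]; norm_num
    rw [this]
    calc Real.exp 1 ^ 5 ≤ 3 ^ 5 := pow_le_pow_left₀ (Real.exp_pos 1).le h.le 5
      _ ≤ 2 ^ 8 := by norm_num
  have hn4 : (n : ℝ) ^ 4 ≤ (2 * s) ^ 16 := by
    have h4 : (n : ℝ) ≤ (s + 1) ^ 4 := by exact_mod_cast hn
    have h5 : (s : ℝ) + 1 ≤ 2 * s := by linarith [show (1 : ℝ) ≤ 2 ^ 22 by norm_num]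
    calc (n : ℝ) ^ 4 ≤ (((s : ℝ) + 1) ^ 4) ^ 4 := pow_le_pow_left₀ (by positivity) h4 4
      _ = ((s : ℝ) + 1) ^ 16 := by ring
      _ ≤ _ := pow_le_pow_left₀ (by positivity) h5 16
  have hs2 : (2 : ℝ) ^ 44 ≤ (s : ℝ) ^ 2 := by
    calc (2 : ℝ) ^ 44 = (2 ^ 22) ^ 2 := by norm_num
      _ ≤ _ := pow_le_pow_left₀ (by positivity) hs' 2
  calc 2 * ((2 * (s : ℝ)) ^ 9 * (Real.exp 5 * n ^ 4))
      ≤ 2 * ((2 * (s : ℝ)) ^ 9 * (2 ^ 8 * (2 * s) ^ 16)) := by gcongr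
    _ = 2 ^ 34 * (s : ℝ) ^ 25 := by ring
    _ ≤ (2 ^ 44 / 2 ^ 9) * (s : ℝ) ^ 25 := by
        refine mul_le_mul_of_nonneg_right (by norm_num) (by positivity)
    _ ≤ ((s : ℝ) ^ 2 / 2 ^ 9) * (s : ℝ) ^ 25 := by gcongr
    _ = ((s : ℝ) ^ 3 / 2) ^ 9 := by ring

/-- At least `(d/e)^n / 2` permutations have fewer than `s^3` cycles of length at most `s`; with at
most `n/s ≤ 16 s^3` longer ones they have at most `17 s^3` cycles. Encoding them by orderings and
removing the breaks each cost `n^(2 (17 s^3 + 1))`, and passing to Hamilton cycles costs `n^2`;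
together the exponent is `68 s^3 + 6`. -/
theorem pow_le_numHamiltonCycles_mul (hG : G.IsRegularOfDegree d) (hn : Fintype.card V ≤ 2 * d)
    {s : ℕ} (hs : 2 ^ 22 ≤ s) (hsn : s ^ 4 ≤ Fintype.card V) (hns : Fintype.card V ≤ (s + 1) ^ 4) :
    ((d : ℝ) / Real.exp 1) ^ Fintype.card V ≤
      2 * (Fintype.card V : ℝ) ^ (68 * s ^ 3 + 6) * G.numHamiltonCycles := by
  have hs4 : (2 ^ 22) ^ 2 * s ^ 2 ≤ s ^ 4 := by
    calc (2 ^ 22) ^ 2 * s ^ 2 ≤ s ^ 2 * s ^ 2 :=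
          Nat.mul_le_mul_right _ (Nat.pow_le_pow_left hs 2)
      _ = s ^ 4 := by ring
  have hss : s ≤ s ^ 2 := Nat.le_self_pow two_ne_zero s
  have hd : 0 < d := by omega
  have hd0 : (0 : ℝ) < d := by exact_mod_cast hd
  obtain ⟨k, hk⟩ : ∃ k, Fintype.card V = k + 3 := ⟨Fintype.card V - 3, by omega⟩
  set X := ((d : ℝ) / Real.exp 1) ^ Fintype.card V with hX
  have hX0 : 0 < X := by positivity
  have hperm := pow_le_card_adjPerms hG hd
  -- few permutations have many short cycles
  have hbad := card_filter_shortCycles_le (l := s) (M := 9 * s) (j := 9) (K := s ^ 3)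
    (B := X * (Real.exp 5 * Fintype.card V ^ 4)) hd hG (fun S hS => by
      refine card_adjPerms_mul_le hG hd hn (by omega) (by omega) ?_
      have : S.card ^ 2 ≤ (9 * s) ^ 2 := Nat.pow_le_pow_left hS 2
      rw [mul_pow] at this
      omega) le_rfl
  set bad := (G.adjPerms ∅).filter fun σ => s ^ 3 ≤ (shortCycles σ s).card with hbaddef
  have hbad2 : (bad.card : ℝ) ≤ X / 2 := by
    have hD := descFactorial_cube_ge hs hns
    have hD0 : (0 : ℝ) < ((s ^ 3).descFactorial 9 : ℝ) := by
      refine lt_of_lt_of_le ?_ hD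
      have : 0 < s := by omega
      have : 0 < Fintype.card V := by omega
      positivity
    have h1 : (bad.card : ℝ) * (s ^ 3).descFactorial 9 * d ^ 9 ≤
        ((2 * s) ^ 9 * (X * (Real.exp 5 * Fintype.card V ^ 4))) * d ^ 9 := by
      refine hbad.trans ?_
      have h2 : (Fintype.card V : ℝ) ≤ 2 * d := by exact_mod_cast hn
      calc ((Fintype.card V : ℝ) * s) ^ 9 * (X * (Real.exp 5 * Fintype.card V ^ 4))
          ≤ (2 * d * s) ^ 9 * (X * (Real.exp 5 * Fintype.card V ^ 4)) := by gcongr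
        _ = _ := by ring
    have h3 := le_of_mul_le_mul_right h1 (by positivity)
    have h4 : (2 * s : ℝ) ^ 9 * (X * (Real.exp 5 * Fintype.card V ^ 4)) ≤
        X / 2 * (s ^ 3).descFactorial 9 := by
      have := mul_le_mul_of_nonneg_left hD (show 0 ≤ X / 2 by positivity)
      refine le_trans (le_of_eq ?_) this
      ring
    exact le_of_mul_le_mul_right (h3.trans h4) hD0
  -- the others have few cycles
  have hgood : (G.adjPerms ∅).card ≤ bad.card +
      ((G.adjPerms ∅).filter fun σ => σ.cycleFactorsFinset.card ≤ 17 * s ^ 3).card := by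
    rw [← card_filter_add_card_filter_not (s := G.adjPerms ∅)
      (fun σ => s ^ 3 ≤ (shortCycles σ s).card)]
    refine Nat.add_le_add_left (card_le_card fun σ hσ => ?_) _
    obtain ⟨h1, h2⟩ := mem_filter.mp hσ
    refine mem_filter.mpr ⟨h1, ?_⟩
    have h3 := card_cycleFactorsFinset_mul_le σ s
    have h4 : Fintype.card V ≤ 16 * s ^ 3 * s := by
      calc Fintype.card V ≤ (s + 1) ^ 4 := hns
        _ ≤ (2 * s) ^ 4 := Nat.pow_le_pow_left (by omega) 4
        _ = 16 * s ^ 3 * s := by ring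
    have h5 : (shortCycles σ s).card * s ≤ s ^ 3 * s := Nat.mul_le_mul_right _ (not_le.mp h2).le
    refine Nat.le_of_mul_le_mul_right ?_ (show 0 < s by omega)
    linarith
  have hfew := card_filter_cycles_le (G := G) (m := k + 2) hk (17 * s ^ 3)
  have hord := card_orderings_le hG (m := k + 2) (by omega) (17 * s ^ 3 + 1)
  have hham := card_orderings_zero_le (G := G) k hk
  have htot : ((G.adjPerms ∅).filter fun σ => σ.cycleFactorsFinset.card ≤ 17 * s ^ 3).card ≤
      Fintype.card V ^ (68 * s ^ 3 + 6) * G.numHamiltonCycles := by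
    rw [hk]
    refine hfew.trans ((Nat.mul_le_mul_right _ hord).trans ?_)
    calc (k + 2 + 1) ^ (2 * (17 * s ^ 3 + 1)) * (G.orderings (k + 2) 0).card *
          (k + 2 + 1) ^ (2 * (17 * s ^ 3 + 1))
        ≤ (k + 2 + 1) ^ (2 * (17 * s ^ 3 + 1)) * (G.numHamiltonCycles * (k + 3) ^ 2) *
          (k + 2 + 1) ^ (2 * (17 * s ^ 3 + 1)) := by gcongr
      _ = (k + 3) ^ (68 * s ^ 3 + 6) * G.numHamiltonCycles := by ring
  have hgood' : ((G.adjPerms ∅).card : ℝ) ≤ bad.card +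
      (Fintype.card V : ℝ) ^ (68 * s ^ 3 + 6) * G.numHamiltonCycles := by
    exact_mod_cast hgood.trans (Nat.add_le_add_left htot _)
  linarith

theorem eventually_lower_error {δ : ℝ} (hδ : 0 < δ) :
    ∀ᶠ s : ℕ in atTop, Real.log 2 + (68 * (s : ℝ) ^ 3 + 6) * (4 * Real.log (s + 1)) ≤
      δ * (s : ℝ) ^ 4 := by
  have hlog : ∀ᶠ s : ℕ in atTop, Real.log ((s : ℝ) + 1) ≤ δ / 1200 * (s + 1) := by
    have h := Real.isLittleO_log_id_atTop.bound (show 0 < δ / 1200 by positivity)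
    have ht : Tendsto (fun s : ℕ => (s : ℝ) + 1) atTop atTop :=
      tendsto_atTop_add_const_right _ _ tendsto_natCast_atTop_atTop
    filter_upwards [ht.eventually h] with s hs
    simp only [id, Real.norm_eq_abs] at hs
    rw [abs_of_pos (show (0 : ℝ) < s + 1 by positivity)] at hs
    exact (le_abs_self _).trans hs
  have hbig : ∀ᶠ s : ℕ in atTop, 2 / δ ≤ (s : ℝ) :=
    tendsto_natCast_atTop_atTop.eventually (eventually_ge_atTop _)
  filter_upwards [hlog, hbig, eventually_ge_atTop 1] with s h1 h2 h3
  have hs : (1 : ℝ) ≤ s := by exact_mod_cast h3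
  have h4 : Real.log ((s : ℝ) + 1) ≤ δ / 600 * s := by
    refine h1.trans ?_
    have : δ / 1200 * ((s : ℝ) + 1) ≤ δ / 1200 * (2 * s) :=
      mul_le_mul_of_nonneg_left (by linarith) (by positivity)
    linarith
  have h5 : (1 : ℝ) ≤ (s : ℝ) ^ 3 := one_le_pow₀ hs
  have h6 : Real.log 2 ≤ 1 := by
    have := Real.log_le_sub_one_of_pos (show (0 : ℝ) < 2 by norm_num)
    linarith
  have h7 : 2 ≤ δ * s := by
    rw [div_le_iff₀ hδ] at h2
    linarith
  have h8 : (68 * (s : ℝ) ^ 3 + 6) * (4 * Real.log (s + 1)) ≤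
      (74 * (s : ℝ) ^ 3) * (4 * (δ / 600 * s)) := by
    refine mul_le_mul (by linarith) (by linarith) ?_ (by positivity)
    have := Real.log_nonneg (show (1 : ℝ) ≤ s + 1 by linarith)
    linarith
  have h9 : (2 : ℝ) ≤ δ * s * (s : ℝ) ^ 3 := by
    calc (2 : ℝ) ≤ δ * s := h7
      _ ≤ δ * s * (s : ℝ) ^ 3 := le_mul_of_one_le_right (by linarith) h5
  have h10 : (74 * (s : ℝ) ^ 3) * (4 * (δ / 600 * s)) = 296 / 600 * (δ * s * (s : ℝ) ^ 3) := by ring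
  have h11 : δ * (s : ℝ) ^ 4 = δ * s * (s : ℝ) ^ 3 := by ring
  rw [h11]
  linarith

theorem eventually_upper_error {δ : ℝ} (hδ : 0 < δ) :
    ∀ᶠ n : ℕ in atTop, 5 + 4 * Real.log n ≤ δ * n := by
  have h := Real.isLittleO_log_id_atTop.bound (show 0 < δ / 8 by positivity)
  have hbig : ∀ᶠ n : ℕ in atTop, 10 / δ ≤ (n : ℝ) :=
    tendsto_natCast_atTop_atTop.eventually (eventually_ge_atTop _)
  filter_upwards [tendsto_natCast_atTop_atTop.eventually h, hbig] with n h1 h2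
  simp only [id, Real.norm_eq_abs, Nat.abs_cast] at h1
  have h3 := (le_abs_self _).trans h1
  rw [div_le_iff₀ hδ] at h2
  linarith

end Asymptotics

/-- In a regular graph of degree at least half of the order, the number of Hamilton cycles is
`(d / e) ^ n` up to a factor which is subexponential in the order. -/
theorem numHamiltonCycles_bounds {ε : ℝ} (hε : 0 < ε) (hε1 : ε < 1) :
    ∃ N : ℕ, ∀ n : ℕ, N ≤ n →
      ∀ (V : Type*) [Fintype V] [DecidableEq V] (G : SimpleGraph V) [DecidableRel G.Adj] (d : ℕ),
        Fintype.card V = n → n ≤ 2 * d → G.IsRegularOfDegree d →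
          0 < n ∧ 0 < d ∧
          ((d : ℝ) / Real.exp 1) ^ n * (1 - ε) ^ n ≤ G.numHamiltonCycles ∧
          (G.numHamiltonCycles : ℝ) ≤ ((d : ℝ) / Real.exp 1) ^ n * (1 + ε) ^ n := by
  have hlow : 0 < - Real.log (1 - ε) := by
    have := Real.log_neg (show 0 < 1 - ε by linarith) (by linarith)
    linarith
  obtain ⟨s₀, hs₀⟩ := eventually_atTop.mp (eventually_lower_error hlow)
  obtain ⟨n₀, hn₀⟩ := eventually_atTop.mp (eventually_upper_error
    (Real.log_pos (show 1 < 1 + ε by linarith)))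
  refine ⟨max (max s₀ (2 ^ 22) ^ 4) n₀, fun n hn V _ _ G _ d hV hd hG => ?_⟩
  have hn1 := (le_max_left _ _).trans hn
  have hn2 := hn₀ n ((le_max_right _ _).trans hn)
  -- The integer part of `n^(1/4)`.
  set s := Nat.sqrt (Nat.sqrt n) with hs
  have hs1 : max s₀ (2 ^ 22) ≤ s := by
    rw [hs, Nat.le_sqrt', Nat.le_sqrt', ← pow_mul]
    exact hn1
  have hs4 : s ^ 4 ≤ n := by
    have : s ^ 4 = (s ^ 2) ^ 2 := by ring
    rw [this, ← Nat.le_sqrt', ← Nat.le_sqrt']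
  have hs5 : n ≤ (s + 1) ^ 4 := by
    have h1 : Nat.sqrt n < (s + 1) ^ 2 := Nat.sqrt_lt'.mp (Nat.lt_succ_self s)
    have h2 : n < ((s + 1) ^ 2) ^ 2 := Nat.sqrt_lt'.mp h1
    rw [← pow_mul] at h2
    exact h2.le
  have hs22 : 2 ^ 22 ≤ s := (le_max_right _ _).trans hs1
  have hs0 : 0 < s := lt_of_lt_of_le (by norm_num) hs22
  have hn0 : 0 < n := lt_of_lt_of_le (pow_pos hs0 4) hs4
  have hnR : (0 : ℝ) < n := by exact_mod_cast hn0
  have hd0 : 0 < d := by omega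
  have hdR : (0 : ℝ) < d := by exact_mod_cast hd0
  set X := ((d : ℝ) / Real.exp 1) ^ n with hX
  have hX0 : 0 < X := by positivity
  refine ⟨hn0, hd0, ?_, ?_⟩
  · have h1 := pow_le_numHamiltonCycles_mul hG (by rw [hV]; exact hd) hs22 (by rw [hV]; exact hs4)
      (by rw [hV]; exact hs5)
    rw [hV, ← hX] at h1
    have h2 : 2 * (n : ℝ) ^ (68 * s ^ 3 + 6) * (1 - ε) ^ n ≤ 1 := by
      have hpos : 0 < 1 - ε := by linarith
      rw [← Real.log_nonpos_iff (by positivity), Real.log_mul (by positivity) (by positivity),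
        Real.log_mul (by norm_num) (by positivity), Real.log_pow, Real.log_pow]
      have h3 := hs₀ s ((le_max_left _ _).trans hs1)
      have h4 : Real.log n ≤ 4 * Real.log (s + 1) := by
        have : (n : ℝ) ≤ ((s : ℝ) + 1) ^ 4 := by exact_mod_cast hs5
        have h5 := Real.log_le_log hnR this
        rw [Real.log_pow] at h5
        exact_mod_cast h5
      have h6 : (s : ℝ) ^ 4 ≤ n := by exact_mod_cast hs4
      have h7 := mul_le_mul_of_nonneg_left h4 (show (0 : ℝ) ≤ 68 * (s : ℝ) ^ 3 + 6 by positivity)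
      have h8 := mul_le_mul_of_nonneg_left h6 hlow.le
      push_cast
      linarith
    have hpos : 0 ≤ (1 - ε) ^ n := pow_nonneg (by linarith) n
    calc X * (1 - ε) ^ n ≤
          2 * (n : ℝ) ^ (68 * s ^ 3 + 6) * G.numHamiltonCycles * (1 - ε) ^ n :=
          mul_le_mul_of_nonneg_right h1 hpos
      _ = (2 * (n : ℝ) ^ (68 * s ^ 3 + 6) * (1 - ε) ^ n) * G.numHamiltonCycles := by ring
      _ ≤ 1 * G.numHamiltonCycles := mul_le_mul_of_nonneg_right h2 (Nat.cast_nonneg _)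
      _ = _ := one_mul _
  · have h1 := numHamiltonCycles_le_mul hG hd0 (by rw [hV]; exact hd) (by rw [hV]; exact hn0)
    rw [hV] at h1
    refine h1.trans (mul_le_mul_of_nonneg_left ?_ hX0.le)
    rw [← Real.log_le_log_iff (by positivity) (by positivity),
      Real.log_mul (by positivity) (by positivity), Real.log_exp, Real.log_pow, Real.log_pow]
    push_cast
    linarith

end SimpleGraph

theorem corollary1p5 (c : ℝ) (hc : 1 / 2 ≤ c) (ε : ℝ) (hε : 0 < ε) :
    ∃ N : ℕ, ∀ n : ℕ, N ≤ n →
      ∀ (V : Type*) [Fintype V] [DecidableEq V] (G : SimpleGraph V) [DecidableRel G.Adj] (d : ℕ),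
        Fintype.card V = n → (d : ℝ) = c * n → G.IsRegularOfDegree d →
          ∃ η : ℝ, |η| ≤ ε ∧
            (G.numHamiltonCycles : ℝ) = (c * n / Real.exp 1) ^ n * (1 + η) ^ n := by
  -- Capping the error at `1/2` keeps `1 - ε` positive, as the lower bound requires.
  have hε' : 0 < min ε (1 / 2) := lt_min hε (by norm_num)
  have hε1 : min ε (1 / 2) < 1 := lt_of_le_of_lt (min_le_right _ _) (by norm_num)
  obtain ⟨N, hN⟩ := SimpleGraph.numHamiltonCycles_bounds hε' hε1
  refine ⟨N, fun n hn V _ _ G _ d hV hd hG => ?_⟩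
  have hnd : n ≤ 2 * d := by
    have h1 : (0 : ℝ) ≤ n := Nat.cast_nonneg n
    have h2 : (n : ℝ) ≤ 2 * d := by rw [hd]; nlinarith
    exact_mod_cast h2
  obtain ⟨hn0, hd0, hlow, hup⟩ := hN n hn V G d hV hnd hG
  rw [← hd]
  have hdR : (0 : ℝ) < d := by exact_mod_cast hd0
  set X := ((d : ℝ) / Real.exp 1) ^ n with hX
  have hX0 : 0 < X := by positivity
  -- The equation forces the choice `η = y - 1` with `y` the `n`-th root of the ratio; the two
  -- bounds on the count become bounds on `y`.
  set y : ℝ := ((G.numHamiltonCycles : ℝ) / X) ^ ((n : ℝ)⁻¹) with hy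
  have hy0 : 0 ≤ y := Real.rpow_nonneg (by positivity) _
  have hyn : y ^ n = G.numHamiltonCycles / X :=
    Real.rpow_inv_natCast_pow (by positivity) hn0.ne'
  have h1 : 1 - min ε (1 / 2) ≤ y := by
    refine (pow_le_pow_iff_left₀ (by linarith) hy0 hn0.ne').mp ?_
    rw [hyn, le_div_iff₀ hX0]
    linarith
  have h2 : y ≤ 1 + min ε (1 / 2) := by
    refine (pow_le_pow_iff_left₀ hy0 (by linarith) hn0.ne').mp ?_
    rw [hyn, div_le_iff₀ hX0]
    linarith
  have h3 := min_le_left ε (1 / 2)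
  refine ⟨y - 1, abs_le.mpr ⟨by linarith, by linarith⟩, ?_⟩
  rw [add_sub_cancel, hyn, mul_div_cancel₀ _ hX0.ne']
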